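/- **Setting.** Let $(C,CE)$ and $(D,DE)$ be finite category presentations (finitely many objects, generating morphisms and path equations), let $F:(C,CE)\to(D,DE)$ be a morphism of presentations (generating morphisms go to paths, equations to provably equal paths), and let $I$ be a $C$-algebra satisfying $CE$ with all sets $I(c)$ finite; write $C,D,F,I$ also for the presented categories and the induced functors. *Theory and input.* ${\sf cog}(F)$ is the cartesian theory of the cograph of $F$. The cograph is presented by the generators and equations of $C$ and $D$, one generator $\alpha_c:c\to F(c)$ per object $c$ of $C$, and the equation $F(f)\circ\alpha_c=\alpha_{c'}\circ f$ per generator $f:c\to c'$ of $C$. Its theory has a binary relation symbol for each generator; its axioms are $\forall x\,\exists!y.\,f(x,y)$ for each generator $f$, and, for each equation $p=q$, the statement that the two ends of chains along $p$ and $q$ from the same $x$ are equal. Each axiom $\phi\Rightarrow\exists!\,\vec y.\,\psi$ is rewritten as the tgd or egd $\phi\Rightarrow\exists\vec y.\,\psi$ and the egd expressing uniqueness. $\mathcal I$ is the instance equal to $I$ on the sorts and relations of $C$ and empty elsewhere. *Fast parallel chase* of a theory on $I_0$. Start with $I_{\rm cur}=I_0$. While there is an active trigger of a tgd, or in the first pass,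 do: one parallel chase step with all active triggers of tgds; then, while there is an active trigger of an egd, a parallel chase step with all active triggers of egds. The composite $I_0\to I_{\rm cur}$ is recorded. A trigger of $\xi$ is a morphism $f:{\sf front}\to I_{\rm cur}$ from the frozen instance of the premise of $\xi$; it is active if it does not factor through the frozen instance ${\sf back}$ of premise and conclusion; a parallel chase step is the pushout of $\coprod{\sf front}_f\to\coprod{\sf back}_f$ along the copairing of the triggers. *Fast left Kan algorithm.* A state consists of sets $J(d)$, equivalence relations $\sim_d$ on $J(d)$, relations $J(g)\subseteq J(d_1)\times J(d_2)$ for the generators $g:d_1\to d_2$ of $D$, and functions $\eta(c):I(c)\to J(Fc)$. Together with $I$ it is an instance of the signature of ${\sf cog}(F)$ ($\alpha_c$ being the graph of $\eta(c)$), with a morphism from $\mathcal I$ that is the identity over $C$. The initial state $S_0$ has $J(d)=\bigsqcup_{Fc=d}I(c)$, $J(g)=\varnothing$, $\eta(c)(v)=(c,v)$. While there is an active trigger of a tgd, or in the first pass, do: reset every $\sim_d$ to the identity; $\alpha$; then, while there is an active trigger of an egd, $\beta_D,\beta_F,\delta,\gamma$. Here - $\alpha$ adds, for each $g:d_1\to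 d_2$ and $u\in J(d_1)$ with no $(u,v)\in J(g)$, a fresh element $g(u)$ to $J(d_2)$ and the pair $(u,g(u))$ to $J(g)$; - $\beta_D$ adds to $\sim$ all pairs $v\in p(u)$, $v'\in q(u)$ for the equations $p=q$ of $D$; - $\beta_F$ adds all pairs $\eta(c')(f(u))$, $v\in F(f)(\eta(c)(u))$ for the generators $f:c\to c'$ of $C$ and $u\in I(c)$; - $\delta$ adds all pairs $v\ne v'$ with $(u,v),(u,v')\in J(g)$; - $\gamma$ replaces all entries of $J$ and $\eta$ by their $\sim$-classes (each time $\sim$ is closed to an equivalence relation). **Proposition.** The fast left Kan algorithm instantiates the fast parallel chase for the theory ${\sf cog}(F)$ and the input $\mathcal I$, and it computes finite left Kan extensions completely. That is: 1. The passage $\mathcal I\to S_0$ made by the initialization is the parallel chase step with all active triggers of tgds of ${\sf cog}(F)$ in $\mathcal I$, i.e. the first step of the fast parallel chase on $\mathcal I$. 2. From $S_0$ on (at the start of the outer loop, in its first pass), every transition of the fast left Kan algorithm is, on the associated instances under $\mathcal I$, the corresponding transition of the fast parallel chase for ${\sf cog}(F)$: resetting $\sim$ followed by $\alpha$ is the parallel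 chase step with all active triggers of tgds; $\beta_D,\beta_F,\delta,\gamma$ together are the parallel chase step with all active triggers of egds; and the loops are left at the same moments. 3. If $F$ sends no generating morphism of $C$ to a path of length $0$, then $S_0$ has no active triggers of egds. Whenever $S_0$ has none, the fast parallel chase on $\mathcal I$ passes, after its first step, from the inner loop at $S_0$ directly to the test of the outer loop at $S_0$. If $S_0$ then has active triggers of tgds, its next transition leads to the first configuration that the fast left Kan algorithm reaches from $S_0$, so the runs coincide from there on; otherwise it halts at $S_0$, and the fast left Kan algorithm halts after one pass with a state isomorphic to $S_0$ under $\mathcal I$. 4. For all inputs, the fast left Kan algorithm halts if and only if the fast parallel chase for ${\sf cog}(F)$ on $\mathcal I$ halts, and then their results are isomorphic under $\mathcal I$. 5. If the fast left Kan algorithm halts, its final $(J,\eta)$ is, up to renaming of elements, a left Kan extension of $I$ along $F$ with its unit, and all its sets are finite. 6. If the left Kan extension $\Sigma_F(I)$ is finite (all $\Sigma_F(I)(d)$ are finite), then the fast left Kan algorithm halts. -/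

import Mathlib

universe u

namespace FastKan

open CategoryTheory

/-! ### Presentations of categories, morphisms of presentations, algebras -/

/-- A category presentation `(Q, E)`: a quiver together with a set of pairs of parallel paths. -/
structure CatPres : Type (u + 1) where
  Ob : Type u
  [quiver : Quiver.{u} Ob]
  eqn : ∀ ⦃a b : Ob⦄, Quiver.Path a b → Quiver.Path a b → Prop

attribute [instance] CatPres.quiver

/-- A presentation is finite if it has finitely many objects, generating morphisms and equations. -/
structure CatPres.IsFinite (P : CatPres.{u}) : Prop where
  ob : Finite P.Ob
  hom : ∀ a b : P.Ob, Finite (a ⟶ b)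
  eqn : ∀ a b : P.Ob, Set.Finite {e : Quiver.Path a b × Quiver.Path a b | P.eqn e.1 e.2}

/-- The path equations, as a relation on the morphisms of the free category. -/
def CatPres.homRel (P : CatPres.{u}) : HomRel (Paths P.Ob) :=
  fun _ _ p q => P.eqn p q

/-- The category presented by `P`: the quotient of the free category by the smallest
congruence containing the equations. -/
abbrev CatPres.Cat (P : CatPres.{u}) : Type u := CategoryTheory.Quotient P.homRel

/-- The projection of the free category onto the presented category. -/
abbrev CatPres.proj (P : CatPres.{u}) : Paths P.Ob ⥤ P.Cat := CategoryTheory.Quotient.functor P.homRel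

/-- A morphism of presentations: it sends a generating morphism to a path, and the two sides of an
equation to provably equal paths. -/
structure PresMor (C D : CatPres.{u}) where
  obj : C.Ob → D.Ob
  map : ∀ {a b : C.Ob}, (a ⟶ b) → Quiver.Path (obj a) (obj b)
  respects : ∀ {a b : C.Ob} (p q : Quiver.Path a b), C.eqn p q →
    D.proj.map ((Paths.lift (C := Paths D.Ob) { obj := obj, map := fun f => map f }).map p) =
      D.proj.map ((Paths.lift (C := Paths D.Ob) { obj := obj, map := fun f => map f }).map q)

/-- The functor between free categories given by a morphism of presentations. -/
def PresMor.onPaths {C D : CatPres.{u}} (F : PresMor C D) : Paths C.Ob ⥤ Paths D.Ob :=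
  Paths.lift { obj := F.obj, map := fun f => F.map f }

/-- The functor between presented categories given by a morphism of presentations. -/
def PresMor.functor {C D : CatPres.{u}} (F : PresMor C D) : C.Cat ⥤ D.Cat :=
  CategoryTheory.Quotient.lift C.homRel (F.onPaths ⋙ D.proj) (fun _ _ p q h => F.respects p q h)

/-- An algebra on the quiver of `C` that satisfies the equations of `C`. -/
structure Algebra (C : CatPres.{u}) where
  toPrefunctor : C.Ob ⥤q Type u
  sat : ∀ {a b : C.Ob} (p q : Quiver.Path a b), C.eqn p q →
    (Paths.lift toPrefunctor).map p = (Paths.lift toPrefunctor).map q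

/-- The set of elements of an algebra at an object. -/
abbrev Algebra.obj {C : CatPres.{u}} (I : Algebra C) (c : C.Ob) : Type u := I.toPrefunctor.obj c

/-- The function by which a generating morphism acts on an algebra. -/
abbrev Algebra.app {C : CatPres.{u}} (I : Algebra C) {c c' : C.Ob} (f : c ⟶ c') (x : I.obj c) :
    I.obj c' := I.toPrefunctor.map f x

/-- The set-valued functor on the presented category given by an algebra. -/
def Algebra.functor {C : CatPres.{u}} (I : Algebra C) : C.Cat ⥤ Type u :=
  CategoryTheory.Quotient.lift C.homRel (Paths.lift I.toPrefunctor) (fun _ _ p q h => I.sat p q h)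

/-- An element of an algebra, as an element of the corresponding functor. -/
def Algebra.elt {C : CatPres.{u}} (I : Algebra C) {c : C.Ob} (x : I.obj c) :
    I.functor.obj (C.proj.obj c) := x

/-! ### Signatures and instances -/

/-- Tuples of elements of a sorted family whose sorts are prescribed by a list. -/
def Tup {S : Type u} (X : S → Type u) : List S → Type u
  | [] => PUnit
  | s :: l => X s × Tup X l

/-- Apply a sorted family of functions to a tuple. -/
def Tup.map {S : Type u} {X Y : S → Type u} (f : ∀ s, X s → Y s) :
    ∀ {l : List S}, Tup X l → Tup Y l
  | [], _ => PUnit.unit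
  | s :: _, v => (f s v.1, Tup.map f v.2)

theorem Tup.map_id {S : Type u} {X : S → Type u} :
    ∀ {l : List S} (v : Tup X l), Tup.map (fun _ x => x) v = v
  | [], _ => rfl
  | _ :: _, v => Prod.ext rfl (Tup.map_id v.2)

theorem Tup.map_map {S : Type u} {X Y Z : S → Type u} (f : ∀ s, X s → Y s)
    (g : ∀ s, Y s → Z s) :
    ∀ {l : List S} (v : Tup X l), Tup.map g (Tup.map f v) = Tup.map (fun s x => g s (f s x)) v
  | [], _ => rfl
  | _ :: _, v => Prod.ext rfl (Tup.map_map f g v.2)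

/-- A (multi-sorted, relational) signature. -/
structure Signature : Type (u + 1) where
  Sorts : Type u
  Rel : Type u
  arity : Rel → List Sorts

/-- An instance on a signature. -/
structure Inst (σ : Signature.{u}) : Type (u + 1) where
  carrier : σ.Sorts → Type u
  rel : ∀ r : σ.Rel, Tup carrier (σ.arity r) → Prop

/-- A morphism of instances. -/
@[ext]
structure InstHom {σ : Signature.{u}} (I J : Inst σ) : Type u where
  toFun : ∀ s, I.carrier s → J.carrier s
  map_rel : ∀ (r : σ.Rel) (v : Tup I.carrier (σ.arity r)), I.rel r v → J.rel r (v.map toFun)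

instance {σ : Signature.{u}} : Category.{u} (Inst σ) where
  Hom := InstHom
  id I := ⟨fun _ x => x, fun r v h => by rw [Tup.map_id]; exact h⟩
  comp f g := ⟨fun s x => g.toFun s (f.toFun s x), fun r v h => by
    rw [← Tup.map_map]; exact g.map_rel r _ (f.map_rel r v h)⟩

/-- The coproduct of a family of instances. -/
abbrev sigmaInst {σ : Signature.{u}} {ι : Type u} (X : ι → Inst σ) : Inst σ where
  carrier s := Σ i, (X i).carrier s
  rel r v := ∃ (i : ι) (w : Tup (X i).carrier (σ.arity r)),
    (X i).rel r w ∧ v = w.map (fun _ x => ⟨i, x⟩)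

/-- The copairing of a family of morphisms. -/
def sigmaDesc {σ : Signature.{u}} {ι : Type u} {X : ι → Inst σ} {I : Inst σ}
    (f : ∀ i, X i ⟶ I) : sigmaInst X ⟶ I :=
  InstHom.mk (fun s x => (f x.1).toFun s x.2) (by
    rintro r _ ⟨i, w, hw, rfl⟩
    exact (Tup.map_map (X := (X i).carrier) (Y := (sigmaInst X).carrier) (fun _ x => ⟨i, x⟩)
      (fun s x => (f x.1).toFun s x.2) w) ▸ (f i).map_rel r w hw)

/-- The coproduct of a family of morphisms. -/
def sigmaMap {σ : Signature.{u}} {ι : Type u} {X Y : ι → Inst σ}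
    (f : ∀ i, X i ⟶ Y i) : sigmaInst X ⟶ sigmaInst Y :=
  InstHom.mk (fun s x => ⟨x.1, (f x.1).toFun s x.2⟩) (by
    rintro r _ ⟨i, w, hw, rfl⟩
    refine ⟨i, w.map (f i).toFun, (f i).map_rel r w hw, ?_⟩
    exact (Tup.map_map (Y := (sigmaInst X).carrier) (Z := (sigmaInst Y).carrier) _ _ w).trans
      (Tup.map_map (Y := (Y i).carrier) (Z := (sigmaInst Y).carrier) (f i).toFun
        (fun _ x => ⟨i, x⟩) w).symm)

/-! ### Regular formulas, embedded dependencies, regular and cartesian theories -/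

/-- Atoms with variables in a sorted family `V` of variables. -/
inductive Atom (σ : Signature.{u}) (V : σ.Sorts → Type u) : Type u
  | eq {s : σ.Sorts} (x y : V s) : Atom σ V
  | rel (r : σ.Rel) (x : Tup V (σ.arity r)) : Atom σ V

/-- Renaming of variables in an atom. -/
def Atom.map {σ : Signature.{u}} {V W : σ.Sorts → Type u} (f : ∀ s, V s → W s) :
    Atom σ V → Atom σ W
  | .eq x y => .eq (f _ x) (f _ y)
  | .rel r x => .rel r (x.map f)

/-- The data of a sequent `∀ x, φ(x) ⇒ ∃ y, ψ(x, y)` (or of `∀ x, φ(x) ⇒ ∃! y, ψ(x, y)`), with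
finitely many variables `x` (in `V`) and `y` (in `W`), where the regular formulas `φ` and `ψ` are
the conjunctions of finite sets of atoms. -/
structure Sequent (σ : Signature.{u}) : Type (u + 1) where
  V : σ.Sorts → Type u
  W : σ.Sorts → Type u
  φ : Set (Atom σ V)
  ψ : Set (Atom σ (fun s => V s ⊕ W s))
  finite_V : Finite (Σ s, V s)
  finite_W : Finite (Σ s, W s)
  finite_φ : φ.Finite
  finite_ψ : ψ.Finite

/-- The sequent is an equality-generating dependency. -/
def Sequent.IsEgd {σ : Signature.{u}} (ξ : Sequent σ) : Prop :=
  ∀ a ∈ ξ.ψ, ∃ (s : σ.Sorts) (x y : ξ.V s ⊕ ξ.W s), a = Atom.eq x y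

/-- The sequent is a tuple-generating dependency. -/
def Sequent.IsTgd {σ : Signature.{u}} (ξ : Sequent σ) : Prop :=
  ∀ a ∈ ξ.ψ, ∃ (r : σ.Rel) (x : Tup (fun s => ξ.V s ⊕ ξ.W s) (σ.arity r)), a = Atom.rel r x

/-- The egd `φ(x) ∧ ψ(x, y) ∧ ψ(x, y') ⇒ y = y'` expressing the uniqueness in
`φ(x) ⇒ ∃! y, ψ(x, y)`. -/
def Sequent.uniqueness {σ : Signature.{u}} (ξ : Sequent σ) : Sequent σ where
  V s := ξ.V s ⊕ (ξ.W s ⊕ ξ.W s)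
  W _ := PEmpty
  φ := Atom.map (fun _ => Sum.inl) '' ξ.φ ∪
    (Atom.map (fun _ => Sum.map id Sum.inl) '' ξ.ψ ∪
      Atom.map (fun _ => Sum.map id Sum.inr) '' ξ.ψ)
  ψ := Set.range (fun w : Σ s, ξ.W s =>
    Atom.eq (Sum.inl (Sum.inr (Sum.inl w.2))) (Sum.inl (Sum.inr (Sum.inr w.2))))
  finite_V := by
    have := ξ.finite_V
    have := ξ.finite_W
    refine Finite.of_surjective
      (fun z : (Σ s, ξ.V s) ⊕ ((Σ s, ξ.W s) ⊕ (Σ s, ξ.W s)) =>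
        match z with
        | .inl a => (⟨a.1, Sum.inl a.2⟩ : Σ s, ξ.V s ⊕ (ξ.W s ⊕ ξ.W s))
        | .inr (.inl a) => ⟨a.1, Sum.inr (Sum.inl a.2)⟩
        | .inr (.inr a) => ⟨a.1, Sum.inr (Sum.inr a.2)⟩) ?_
    rintro ⟨s, x | x | x⟩
    · exact ⟨.inl ⟨s, x⟩, rfl⟩
    · exact ⟨.inr (.inl ⟨s, x⟩), rfl⟩
    · exact ⟨.inr (.inr ⟨s, x⟩), rfl⟩
  finite_W := by
    have : IsEmpty (Σ _ : σ.Sorts, PEmpty.{u + 1}) := ⟨fun z => z.2.elim⟩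
    infer_instance
  finite_φ := (ξ.finite_φ.image _).union ((ξ.finite_ψ.image _).union (ξ.finite_ψ.image _))
  finite_ψ := by
    have := ξ.finite_W
    exact Set.finite_range _

/-- A theory: a family of sequents. It is a regular theory if they are read with `∃` (as EDs), and
a cartesian theory if they are read with `∃!`. -/
structure Theory (σ : Signature.{u}) : Type (u + 1) where
  Index : Type u
  ax : Index → Sequent σ

/-- The rewriting of a cartesian theory as a regular theory: each `φ(x) ⇒ ∃! y, ψ(x, y)` is replaced
by the ED `φ(x) ⇒ ∃ y, ψ(x, y)` and the egd that expresses uniqueness. -/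
def Theory.toRegular {σ : Signature.{u}} (T : Theory σ) : Theory σ where
  Index := T.Index ⊕ T.Index
  ax := Sum.elim T.ax (fun i => (T.ax i).uniqueness)

/-- The frozen instance of a regular formula: its variables modulo the equivalence relation
generated by the equational atoms, with the smallest relations making the relational atoms true. -/
abbrev frozen {σ : Signature.{u}} {V : σ.Sorts → Type u} (φ : Set (Atom σ V)) : Inst σ where
  carrier s := Quot (fun x y : V s => Atom.eq x y ∈ φ)
  rel r v := ∃ x : Tup V (σ.arity r), Atom.rel r x ∈ φ ∧ v = x.map (fun _ => Quot.mk _)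

/-- The frozen `φ`-instance. -/
abbrev Sequent.front {σ : Signature.{u}} (ξ : Sequent σ) : Inst σ := frozen ξ.φ

/-- The frozen `(φ ∧ ψ)`-instance. -/
abbrev Sequent.back {σ : Signature.{u}} (ξ : Sequent σ) : Inst σ :=
  frozen (Atom.map (fun _ => Sum.inl) '' ξ.φ ∪ ξ.ψ)

theorem Sequent.eq_mem_back {σ : Signature.{u}} (ξ : Sequent σ) {s : σ.Sorts} {x y : ξ.V s}
    (h : Atom.eq x y ∈ ξ.φ) : (Atom.eq (σ := σ) (V := fun s => ξ.V s ⊕ ξ.W s) (s := s)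
      (Sum.inl x) (Sum.inl y)) ∈ Atom.map (fun _ => Sum.inl) '' ξ.φ ∪ ξ.ψ :=
  Or.inl ⟨_, h, rfl⟩

/-- The morphism `front ⟶ back` sending `[x]` to `[x]`. -/
def Sequent.frontToBack {σ : Signature.{u}} (ξ : Sequent σ) : ξ.front ⟶ ξ.back :=
  InstHom.mk
    (fun _ => Quot.map Sum.inl (fun _ _ h => ξ.eq_mem_back h))
    (by
      rintro r _ ⟨x, hx, rfl⟩
      refine ⟨x.map (fun _ => Sum.inl), Or.inl ⟨_, hx, rfl⟩, ?_⟩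
      exact (Tup.map_map (Y := ξ.front.carrier) (Z := ξ.back.carrier) _ _ x).trans
        (Tup.map_map (Y := fun s => ξ.V s ⊕ ξ.W s) (Z := ξ.back.carrier) (fun _ => Sum.inl)
          (fun _ => Quot.mk _) x).symm)

/-! ### Triggers, parallel chase steps, and the fast parallel chase -/

/-- The triggers in `I` of the EDs of `T`. -/
abbrev Trigger {σ : Signature.{u}} (T : Theory σ) (I : Inst σ) : Type u :=
  Σ i : T.Index, ((T.ax i).front ⟶ I)

/-- A trigger is active if it does not factor through `front ⟶ back`. -/
def Trigger.IsActive {σ : Signature.{u}} {T : Theory σ} {I : Inst σ} (t : Trigger T I) : Prop :=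
  ¬ ∃ g : (T.ax t.1).back ⟶ I, (T.ax t.1).frontToBack ≫ g = t.2

/-- All active triggers of tgds. -/
def activeTgds {σ : Signature.{u}} (T : Theory σ) (I : Inst σ) : Set (Trigger T I) :=
  {t | (T.ax t.1).IsTgd ∧ t.IsActive}

/-- All active triggers of egds. -/
def activeEgds {σ : Signature.{u}} (T : Theory σ) (I : Inst σ) : Set (Trigger T I) :=
  {t | (T.ax t.1).IsEgd ∧ t.IsActive}

/-- `c : I ⟶ I'` is a parallel chase step for the set `𝓕` of triggers: the pushout of
`∐ front ⟶ ∐ back` along the copairing `∐ front ⟶ I` of the triggers. -/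
def IsParallelStep {σ : Signature.{u}} {T : Theory σ} {I I' : Inst σ} (𝓕 : Set (Trigger T I))
    (c : I ⟶ I') : Prop :=
  ∃ g : sigmaInst (fun t : 𝓕 => (T.ax t.1.1).back) ⟶ I',
    IsPushout (sigmaDesc (fun t : 𝓕 => t.1.2))
      (sigmaMap (fun t : 𝓕 => (T.ax t.1.1).frontToBack)) c g

/-- Control points of the two algorithms: at the test of the outer loop (with the value of the
variable `first`), at the test of the inner loop, or halted. -/
inductive Loc : Type
  | outer (first : Bool)
  | inner
  | done

/-- A configuration of the fast parallel chase on the input `I₀`: a control point, the current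
instance and the current morphism from the input. -/
structure ChaseConfig {σ : Signature.{u}} (I₀ : Inst σ) : Type (u + 1) where
  loc : Loc
  cur : Inst σ
  mor : I₀ ⟶ cur

/-- The transitions of the fast parallel chase for a theory `T` comprised of egds and tgds. (Chase
steps, and therefore the successor configurations, are determined up to isomorphism.) -/
inductive ChaseStep {σ : Signature.{u}} (T : Theory σ) {I₀ : Inst σ} :
    ChaseConfig I₀ → ChaseConfig I₀ → Prop
  | tgds (first : Bool) {I I' : Inst σ} (i : I₀ ⟶ I) (c : I ⟶ I')
      (guard : (activeTgds T I).Nonempty ∨ first = true)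
      (step : IsParallelStep (activeTgds T I) c) :
      ChaseStep T ⟨.outer first, I, i⟩ ⟨.inner, I', i ≫ c⟩
  | egds {I I' : Inst σ} (i : I₀ ⟶ I) (c : I ⟶ I')
      (guard : (activeEgds T I).Nonempty)
      (step : IsParallelStep (activeEgds T I) c) :
      ChaseStep T ⟨.inner, I, i⟩ ⟨.inner, I', i ≫ c⟩
  | exitInner {I : Inst σ} (i : I₀ ⟶ I) (guard : ¬ (activeEgds T I).Nonempty) :
      ChaseStep T ⟨.inner, I, i⟩ ⟨.outer false, I, i⟩
  | exitOuter {I : Inst σ} (i : I₀ ⟶ I) (guard : ¬ (activeTgds T I).Nonempty) :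
      ChaseStep T ⟨.outer false, I, i⟩ ⟨.done, I, i⟩

/-- The initial configuration of the fast parallel chase. -/
def ChaseConfig.start {σ : Signature.{u}} (I₀ : Inst σ) : ChaseConfig I₀ := ⟨.outer true, I₀, 𝟙 I₀⟩

/-- The fast parallel chase for `T`, run on `I₀`, halts with the result `i : I₀ ⟶ I`. -/
def ChaseComputes {σ : Signature.{u}} (T : Theory σ) (I₀ : Inst σ) {I : Inst σ} (i : I₀ ⟶ I) :
    Prop :=
  Relation.ReflTransGen (ChaseStep T) (ChaseConfig.start I₀) ⟨.done, I, i⟩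

/-! ### The cartesian theory of a category presentation -/

/-- The signature of a presentation: sorts are objects, and a generating morphism `a ⟶ b` is a
relation symbol of arity `a, b`. -/
abbrev CatPres.signature (P : CatPres.{u}) : Signature.{u} where
  Sorts := P.Ob
  Rel := Σ a b : P.Ob, (a ⟶ b)
  arity f := [f.1, f.2.1]

/-- The variables attached to the vertices of a path other than its source. -/
inductive PathVar {Q : Type u} [Quiver.{u} Q] {a : Q} : ∀ {b : Q}, Quiver.Path a b → Q → Type u
  | last {b c : Q} (p : Quiver.Path a b) (e : b ⟶ c) : PathVar (p.cons e) c
  | older {b c : Q} (p : Quiver.Path a b) (e : b ⟶ c) {t : Q} (x : PathVar p t) :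
      PathVar (p.cons e) t

theorem PathVar.finite {Q : Type u} [Quiver.{u} Q] {a b : Q} (p : Quiver.Path a b) :
    Finite (Σ t, PathVar p t) := by
  induction p with
  | nil => exact @Finite.of_subsingleton _ ⟨fun x => nomatch x.2⟩
  | cons p e ih =>
    refine Finite.of_surjective
      (fun z : Option (Σ t, PathVar p t) => match z with
        | none => (⟨_, PathVar.last p e⟩ : Σ t, PathVar (p.cons e) t)
        | some x => ⟨x.1, PathVar.older p e x.2⟩) ?_
    rintro ⟨t, x⟩
    cases x with
    | last => exact ⟨none, rfl⟩
    | older _ _ x => exact ⟨some ⟨t, x⟩, rfl⟩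

/-- The variable at the target of a path, given the variable `x` at the source and the variables at
the other vertices. -/
def endVar {Q : Type u} [Quiver.{u} Q] {V : Q → Type u} {a : Q} (x : V a) :
    ∀ {b : Q} (p : Quiver.Path a b), (∀ t, PathVar p t → V t) → V b
  | _, .nil, _ => x
  | _, .cons p e, y => y _ (.last p e)

/-- The conjunction `f₀(x, y₀) ∧ f₁(y₀, y₁) ∧ ⋯` along a path. -/
def pathAtoms (P : CatPres.{u}) {V : P.Ob → Type u} {a : P.Ob} (x : V a) :
    ∀ {b : P.Ob} (p : Quiver.Path a b), (∀ t, PathVar p t → V t) → Set (Atom P.signature V)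
  | _, .nil, _ => ∅
  | _, .cons p e, y =>
    insert
      (Atom.rel (σ := P.signature) ⟨_, _, e⟩
        (endVar x p (fun t z => y t (.older p e z)), (y _ (.last p e), PUnit.unit)))
      (pathAtoms P x p (fun t z => y t (.older p e z)))

theorem pathAtoms_finite (P : CatPres.{u}) {V : P.Ob → Type u} {a : P.Ob} (x : V a) {b : P.Ob}
    (p : Quiver.Path a b) (y : ∀ t, PathVar p t → V t) : (pathAtoms P x p y).Finite := by
  induction p with
  | nil => exact Set.finite_empty
  | cons p e ih => exact (ih _).insert _

/-- A single variable, of sort `a`. -/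
inductive OneVar {Q : Type u} (a : Q) : Q → Type u
  | mk : OneVar a a

theorem OneVar.finite {Q : Type u} (a : Q) : Finite (Σ t, OneVar a t) :=
  @Finite.of_subsingleton _ ⟨by rintro ⟨_, ⟨⟩⟩ ⟨_, ⟨⟩⟩; rfl⟩

/-- The variables of the axiom of an equation `p = q`: one for the common source, and one for each
further vertex of `p` and of `q`. -/
inductive EqnVar {Q : Type u} [Quiver.{u} Q] {a b : Q} (p q : Quiver.Path a b) : Q → Type u
  | source : EqnVar p q a
  | left {t : Q} (y : PathVar p t) : EqnVar p q t
  | right {t : Q} (z : PathVar q t) : EqnVar p q t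

/-- The axiom `∀ (x : a), ∃! (y : b), f(x, y)` for a generating morphism `f : a ⟶ b`. -/
def totalAxiom (P : CatPres.{u}) {a b : P.Ob} (f : a ⟶ b) : Sequent P.signature where
  V := OneVar (Q := P.Ob) a
  W := OneVar (Q := P.Ob) b
  φ := ∅
  ψ := {Atom.rel (σ := P.signature) ⟨a, b, f⟩ (Sum.inl .mk, (Sum.inr .mk, PUnit.unit))}
  finite_V := OneVar.finite (Q := P.Ob) a
  finite_W := OneVar.finite (Q := P.Ob) b
  finite_φ := Set.finite_empty
  finite_ψ := Set.finite_singleton _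

/-- The axiom `f₀(x, y₀) ∧ ⋯ ∧ fₘ(yₘ₋₁, yₘ) ∧ g₀(x, z₀) ∧ ⋯ ∧ gₙ(zₙ₋₁, zₙ) ⇒ yₘ = zₙ` for an
equation `p = q`, where `p = f₀, …, fₘ` and `q = g₀, …, gₙ`. -/
def eqnAxiom (P : CatPres.{u}) {a b : P.Ob} (p q : Quiver.Path a b) : Sequent P.signature where
  V := EqnVar p q
  W _ := PEmpty
  φ := pathAtoms P (V := EqnVar p q) EqnVar.source p (fun _ => EqnVar.left) ∪
    pathAtoms P (V := EqnVar p q) EqnVar.source q (fun _ => EqnVar.right)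
  ψ := {Atom.eq (σ := P.signature) (s := b)
    (Sum.inl (endVar (V := EqnVar p q) EqnVar.source p (fun _ => EqnVar.left)))
    (Sum.inl (endVar (V := EqnVar p q) EqnVar.source q (fun _ => EqnVar.right)))}
  finite_V := by
    have := PathVar.finite p
    have := PathVar.finite q
    refine Finite.of_surjective
      (fun z : Option ((Σ t, PathVar p t) ⊕ (Σ t, PathVar q t)) => match z with
        | none => (⟨a, EqnVar.source⟩ : Σ t, EqnVar p q t)
        | some (.inl y) => ⟨y.1, EqnVar.left y.2⟩
        | some (.inr y) => ⟨y.1, EqnVar.right y.2⟩) ?_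
    rintro ⟨t, x⟩
    cases x with
    | source => exact ⟨none, rfl⟩
    | left y => exact ⟨some (.inl ⟨t, y⟩), rfl⟩
    | right z => exact ⟨some (.inr ⟨t, z⟩), rfl⟩
  finite_W := by
    have : IsEmpty (Σ _ : P.signature.Sorts, PEmpty.{u + 1}) := ⟨fun z => z.2.elim⟩
    infer_instance
  finite_φ := (pathAtoms_finite P _ p _).union (pathAtoms_finite P _ q _)
  finite_ψ := Set.finite_singleton _

/-- One axiom for each generating morphism and one for each equation. -/
inductive AxiomIndex (P : CatPres.{u}) : Type u
  | total {a b : P.Ob} (f : a ⟶ b) : AxiomIndex P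
  | eqn {a b : P.Ob} (p q : Quiver.Path a b) (h : P.eqn p q) : AxiomIndex P

/-- The cartesian theory of a category presentation. -/
def CatPres.theory (P : CatPres.{u}) : Theory P.signature where
  Index := AxiomIndex P
  ax
    | .total f => totalAxiom P f
    | .eqn p q _ => eqnAxiom P p q

/-! ### The cograph and the input instance -/

section Cograph

variable {C D : CatPres.{u}}

/-- The generating morphisms of the cograph: those of `C`, those of `D`, and one morphism
`α_c : c ⟶ F c` for each object `c` of `C`. -/
inductive CogHom (F : PresMor C D) : C.Ob ⊕ D.Ob → C.Ob ⊕ D.Ob → Type u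
  | ofC {c c' : C.Ob} (f : c ⟶ c') : CogHom F (.inl c) (.inl c')
  | ofD {d d' : D.Ob} (g : d ⟶ d') : CogHom F (.inr d) (.inr d')
  | cross (c : C.Ob) : CogHom F (.inl c) (.inr (F.obj c))

/-- The objects of the cograph, as a quiver. -/
def CogOb (_ : PresMor C D) : Type u := C.Ob ⊕ D.Ob

instance (F : PresMor C D) : Quiver.{u} (CogOb F) := ⟨CogHom F⟩

/-- The inclusion of (the quiver of) `C` into the cograph. -/
def cogInl (F : PresMor C D) : C.Ob ⥤q CogOb F where
  obj := Sum.inl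
  map f := CogHom.ofC f

/-- The inclusion of (the quiver of) `D` into the cograph. -/
def cogInr (F : PresMor C D) : D.Ob ⥤q CogOb F where
  obj := Sum.inr
  map g := CogHom.ofD g

/-- The generating morphism `α_c : c ⟶ F c` of the cograph. -/
def cogCross (F : PresMor C D) (c : C.Ob) : (cogInl F).obj c ⟶ (cogInr F).obj (F.obj c) :=
  CogHom.cross c

/-- The equations of the cograph: those of `C`, those of `D`, and the equation
`F(f) ∘ α_c = α_c' ∘ f` for each generating morphism `f : c ⟶ c'` of `C`. -/
inductive CogEqn (F : PresMor C D) :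
    ∀ ⦃a b : CogOb F⦄, Quiver.Path a b → Quiver.Path a b → Prop
  | ofC {c c' : C.Ob} (p q : Quiver.Path c c') (h : C.eqn p q) :
      CogEqn F ((cogInl F).mapPath p) ((cogInl F).mapPath q)
  | ofD {d d' : D.Ob} (p q : Quiver.Path d d') (h : D.eqn p q) :
      CogEqn F ((cogInr F).mapPath p) ((cogInr F).mapPath q)
  | cross {c c' : C.Ob} (f : c ⟶ c') :
      CogEqn F ((cogCross F c).toPath.comp ((cogInr F).mapPath (F.map f)))
        (((cogInl F).map f).toPath.comp (cogCross F c').toPath)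

/-- The presentation of the cograph of `F`. -/
abbrev cograph (F : PresMor C D) : CatPres.{u} where
  Ob := CogOb F
  eqn := CogEqn F

/-- The theory `cog(F)`, rewritten as a set of egds and tgds. -/
def cogTheory (F : PresMor C D) : Theory (cograph F).signature := (cograph F).theory.toRegular

/-- The sorts of an instance on the signature of `cog(F)` whose part over `C` is given by `I`. -/
def cogCarrier (F : PresMor C D) (I : Algebra C) (J : D.Ob → Type u) : CogOb F → Type u
  | .inl c => I.obj c
  | .inr d => J d

/-- The relations of such an instance: over `C` the graphs of the functions of `I`. -/
def cogRel (F : PresMor C D) (I : Algebra C) (J : D.Ob → Type u)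
    (edge : ∀ ⦃d d' : D.Ob⦄, (d ⟶ d') → J d → J d' → Prop)
    (cross : ∀ c : C.Ob, I.obj c → J (F.obj c) → Prop) :
    ∀ {a b : CogOb F}, CogHom F a b → cogCarrier F I J a → cogCarrier F I J b → Prop
  | _, _, .ofC f => fun x y => I.app f x = y
  | _, _, .ofD g => fun u v => edge g u v
  | _, _, .cross c => fun x v => cross c x v

/-- The instance on the signature of `cog(F)` given by `I` over `C`, by sets `J` and relations
`edge` over `D`, and by relations `cross` for the morphisms `α_c`. -/
abbrev cogInst (F : PresMor C D) (I : Algebra C) (J : D.Ob → Type u)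
    (edge : ∀ ⦃d d' : D.Ob⦄, (d ⟶ d') → J d → J d' → Prop)
    (cross : ∀ c : C.Ob, I.obj c → J (F.obj c) → Prop) : Inst (cograph F).signature where
  carrier := cogCarrier F I J
  rel r v := cogRel F I J edge cross r.2.2 v.1 v.2.1

/-- The input instance: `I` on the sorts and relation symbols from `C`, and empty elsewhere. -/
abbrev inputInst (F : PresMor C D) (I : Algebra C) : Inst (cograph F).signature :=
  cogInst F I (fun _ => PEmpty) (fun _ _ _ _ _ => False) (fun _ _ _ => False)

/-! ### The fast left Kan algorithm -/

/-- The state of the fast left Kan algorithm. -/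
structure KanState (F : PresMor C D) (I : Algebra C) : Type (u + 1) where
  J : D.Ob → Type u
  sim : ∀ d, Setoid (J d)
  edge : ∀ ⦃d d' : D.Ob⦄, (d ⟶ d') → J d → J d' → Prop
  η : ∀ c : C.Ob, I.obj c → J (F.obj c)

variable {F : PresMor C D} {I : Algebra C}

/-- The instance on the signature of `cog(F)` given by a state. -/
abbrev KanState.toInst (s : KanState F I) : Inst (cograph F).signature :=
  cogInst F I s.J s.edge (fun c x v => s.η c x = v)

/-- The morphism from the input instance to the instance of a state: the identity over `C`. -/
def KanState.fromInput (s : KanState F I) : inputInst F I ⟶ s.toInst :=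
  InstHom.mk
    (fun (a : CogOb F) => match a with
      | .inl _ => fun x => x
      | .inr _ => fun x => x.elim)
    (by
      rintro ⟨a, b, f⟩ v h
      change CogHom F a b at f
      cases f with
      | ofC f => exact h
      | ofD g => exact h.elim
      | cross c => exact h.elim)

/-- Evaluation of a path at `u`, with values in the subsets of `J`. -/
def KanState.eval (s : KanState F I) {d : D.Ob} (u : s.J d) :
    ∀ {d' : D.Ob}, Quiver.Path d d' → Set (s.J d')
  | _, .nil => {u}
  | _, .cons p g => {w | ∃ v ∈ s.eval u p, s.edge g v w}

/-- Update each `∼_d` to the smallest equivalence relation that also includes `R d`. -/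
def KanState.addSim (s : KanState F I) (R : ∀ d, s.J d → s.J d → Prop) : KanState F I :=
  { s with sim := fun d => Relation.EqvGen.setoid (fun v w => (s.sim d) v w ∨ R d v w) }

/-- The first loop: `J(d)` is the set of the pairs `(c, v)` with `F c = d` and `v ∈ I c`, the
relations `J(g)` are empty, `η(c)(v) = (c, v)` and `∼` is the identity. -/
def KanState.initial (F : PresMor C D) (I : Algebra C) : KanState F I where
  J d := Σ c : {c : C.Ob // F.obj c = d}, I.obj c.1
  sim _ := ⊥
  edge _ _ _ _ _ := False
  η c v := ⟨⟨c, rfl⟩, v⟩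

/-- Set each `∼_d` to the identity. -/
def KanState.resetSim (s : KanState F I) : KanState F I := { s with sim := fun _ => ⊥ }

/-- The fresh symbols `g(u)` of sort `d`, where `g : src ⟶ d` is an edge and `u` is an element such
that `(u, v) ∈ J(g)` for no `v`. -/
structure KanState.Fresh (s : KanState F I) (d : D.Ob) : Type u where
  src : D.Ob
  g : src ⟶ d
  u : s.J src
  missing : ¬ ∃ v : s.J d, s.edge g u v

/-- The relations `J(g)` after the action `α`. -/
inductive KanState.AlphaEdge (s : KanState F I) :
    ∀ ⦃d d' : D.Ob⦄, (d ⟶ d') → s.J d ⊕ s.Fresh d → s.J d' ⊕ s.Fresh d' → Prop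
  | old {d d' : D.Ob} (g : d ⟶ d') (u : s.J d) (v : s.J d') (h : s.edge g u v) :
      AlphaEdge s g (.inl u) (.inl v)
  | new {d d' : D.Ob} (g : d ⟶ d') (u : s.J d) (h : ¬ ∃ v : s.J d', s.edge g u v) :
      AlphaEdge s g (.inl u) (.inr ⟨d, g, u, h⟩)

/-- Action `α`: add new elements. -/
def KanState.alpha (s : KanState F I) : KanState F I where
  J d := s.J d ⊕ s.Fresh d
  sim d := Relation.EqvGen.setoid
    (fun x y => ∃ v w : s.J d, (s.sim d) v w ∧ x = .inl v ∧ y = .inl w)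
  edge := s.AlphaEdge
  η c v := .inl (s.η c v)

/-- The coincidences induced by the equations of `D`. -/
inductive KanState.RelD (s : KanState F I) : ∀ d : D.Ob, s.J d → s.J d → Prop
  | mk {d₁ d₂ : D.Ob} (p q : Quiver.Path d₁ d₂) (h : D.eqn p q) (u : s.J d₁) (v v' : s.J d₂)
      (hv : v ∈ s.eval u p) (hv' : v' ∈ s.eval u q) : RelD s d₂ v v'

/-- Action `β_D`: add all coincidences induced by `D`. -/
def KanState.betaD (s : KanState F I) : KanState F I := s.addSim s.RelD

/-- The coincidences induced by `F`. -/
inductive KanState.RelF (s : KanState F I) : ∀ d : D.Ob, s.J d → s.J d → Prop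
  | mk {c c' : C.Ob} (f : c ⟶ c') (u : I.obj c) (v : s.J (F.obj c'))
      (hv : v ∈ s.eval (s.η c u) (F.map f)) : RelF s (F.obj c') (s.η c' (I.app f u)) v

/-- Action `β_F`: add all coincidences induced by `F`. -/
def KanState.betaF (s : KanState F I) : KanState F I := s.addSim s.RelF

/-- The coincidences induced by functionality. -/
inductive KanState.RelFun (s : KanState F I) : ∀ d : D.Ob, s.J d → s.J d → Prop
  | mk {d₁ d₂ : D.Ob} (g : d₁ ⟶ d₂) (u : s.J d₁) (v v' : s.J d₂)
      (hv : s.edge g u v) (hv' : s.edge g u v') (hne : v ≠ v') : RelFun s d₂ v v'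

/-- Action `δ`: add all coincidences induced by functionality. -/
def KanState.delta (s : KanState F I) : KanState F I := s.addSim s.RelFun

/-- Action `γ`: replace every entry by its equivalence class. -/
def KanState.gamma (s : KanState F I) : KanState F I where
  J d := _root_.Quotient (s.sim d)
  sim _ := ⊥
  edge _ _ g x y := ∃ u v, s.edge g u v ∧ Quotient.mk _ u = x ∧ Quotient.mk _ v = y
  η c v := Quotient.mk _ (s.η c v)

open Classical in
/-- The transitions of the fast left Kan algorithm: one pass through the body of the outer loop up to
the inner loop, one pass through the body of the inner loop, or the exit from a loop. -/
noncomputable def kanStep : Loc × KanState F I → Loc × KanState F I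
  | (.outer first, s) =>
    if (activeTgds (cogTheory F) s.toInst).Nonempty ∨ first = true then
      (.inner, s.resetSim.alpha)
    else (.done, s)
  | (.inner, s) =>
    if (activeEgds (cogTheory F) s.toInst).Nonempty then
      (.inner, s.betaD.betaF.delta.gamma)
    else (.outer false, s)
  | (.done, s) => (.done, s)

/-- The run of the fast left Kan algorithm: the configuration after `n` transitions, counted from the
end of the first loop. -/
noncomputable def kanRun (F : PresMor C D) (I : Algebra C) (n : ℕ) : Loc × KanState F I :=
  kanStep^[n] (.outer true, KanState.initial F I)

/-- A configuration of the fast left Kan algorithm, seen as a configuration of the fast parallel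
chase on the input instance. -/
def toChase (x : Loc × KanState F I) : ChaseConfig (inputInst F I) :=
  ⟨x.1, x.2.toInst, x.2.fromInput⟩

/-- The state `s` is, up to renaming of elements, the functor `K : D ⥤ Set` together with the
transformation `κ : I ⟶ K ∘ F`. -/
def KanState.Represents (s : KanState F I) (K : D.Cat ⥤ Type u)
    (κ : I.functor ⟶ F.functor ⋙ K) : Prop :=
  ∃ e : ∀ d : D.Ob, s.J d ≃ K.obj (D.proj.obj d),
    (∀ (d d' : D.Ob) (g : d ⟶ d') (u : s.J d) (v : s.J d'),
      s.edge g u v ↔ K.map (D.proj.map ((Paths.of D.Ob).map g)) (e d u) = e d' v) ∧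
    ∀ (c : C.Ob) (x : I.obj c), e (F.obj c) (s.η c x) = κ.app (C.proj.obj c) (I.elt x)

end Cograph

end FastKan

/-! In the instance of a state, the generators of `C` and the `α_c` are interpreted by functions and
the equations of `C` hold. So a tgd of `cog(F)` can only ask for a missing value `g(u)` over `D`,
and an egd can only force pairs generated by `β_D`, `β_F` and `δ`. The pushout along the active tgd
triggers adjoins one free value per trigger (`isParallelStep_activeTgds`); the pushout along the
active egd triggers is the quotient by the equivalence relation that the forced pairs generate
(`isParallelStep_activeEgds`). These are `α` and `γ`, which gives the correspondence step by step.

The runs start differently: the chase arrives at S₀ at the test of the inner loop, whereas the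
algorithm is at the test of the outer loop and applies `α` before any egd. Hence two runs of
`kanStep` are compared, from `.outer true` and from `.inner`. The second one follows the chase,
which is deterministic up to isomorphism (`ChaseStep.equivalent`). Their intermediate states may
differ, but an invariant is shared: each state is generated by paths from `η` (`Reachable`) and maps
to every model, that is, to every total and saturated state (`WeaklyInitial`). Maps from a reachable
state to a saturated one are unique, so a run that halts ends in an initial model, and any two
results are isomorphic. Models amount to functors `G` on `D` with a transformation from `I` to `G ∘
F`, so an initial model is a left Kan extension (`KanState.isLeftKanExtension`).

The inner loop terminates because each pass through its body lowers the number of elements. If a run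
never halts, its states form a fair chain, and terms modulo eventual equality form a model. A left
Kan extension maps onto this limit, because the limit is reachable. If it is finite, then at some
stage the terms `η(x)` and all generators applied to the finitely many representatives have been
reduced to representatives; from there on saturated states are total
(`IsFairChain.eventually_total`) and the outer loop must exit. So either run halts exactly when the
left Kan extension is finite, and the two halt on the same inputs. -/

namespace FastKan

open CategoryTheory

/-! ### Morphisms of instances -/

section Instances

variable {σ : Signature.{u}}

theorem Inst.hom_ext {I J : Inst σ} {f g : I ⟶ J} (h : ∀ s x, f.toFun s x = g.toFun s x) :
    f = g :=
  InstHom.ext (funext fun s => funext fun x => h s x)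

theorem Inst.congr_toFun {I J : Inst σ} {f g : I ⟶ J} (h : f = g) (s : σ.Sorts)
    (x : I.carrier s) : f.toFun s x = g.toFun s x := by rw [h]

/-- Satisfaction of an atom by an assignment of its variables. -/
def Atom.Holds (X : Inst σ) {V : σ.Sorts → Type u} (v : ∀ s, V s → X.carrier s) :
    Atom σ V → Prop
  | .eq x y => v _ x = v _ y
  | .rel r x => X.rel r (x.map v)

theorem Atom.holds_map (X : Inst σ) {V W : σ.Sorts → Type u} (f : ∀ s, V s → W s)
    (v : ∀ s, W s → X.carrier s) (a : Atom σ V) :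
    (a.map f).Holds X v ↔ a.Holds X (fun s x => v s (f s x)) := by
  cases a with
  | eq x y => exact Iff.rfl
  | rel r x =>
    change X.rel r _ ↔ X.rel r _
    rw [Tup.map_map]

/-- The morphism out of a frozen instance given by an assignment. -/
def frozenDesc {X : Inst σ} {V : σ.Sorts → Type u} {φ : Set (Atom σ V)}
    (v : ∀ s, V s → X.carrier s) (h : ∀ a ∈ φ, a.Holds X v) : frozen φ ⟶ X :=
  InstHom.mk (fun s => Quot.lift (v s) (fun _ _ hxy => h _ hxy)) (by
    rintro r _ ⟨x, hx, rfl⟩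
    have := h _ hx
    change X.rel r (x.map v) at this
    exact (Tup.map_map (Y := (frozen φ).carrier) (Z := X.carrier) _ _ x) ▸ this)

/-- The assignment of the variables given by a morphism out of a frozen instance. -/
def frozenVal {X : Inst σ} {V : σ.Sorts → Type u} {φ : Set (Atom σ V)}
    (f : frozen φ ⟶ X) (s : σ.Sorts) (x : V s) : X.carrier s :=
  f.toFun s (Quot.mk _ x)

theorem frozenVal_holds {X : Inst σ} {V : σ.Sorts → Type u} {φ : Set (Atom σ V)}
    (f : frozen φ ⟶ X) (a : Atom σ V) (ha : a ∈ φ) : a.Holds X (frozenVal f) := by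
  cases a with
  | eq x y =>
    exact congrArg (f.toFun _) (Quot.sound (r := fun x y => Atom.eq x y ∈ φ) ha)
  | rel r x =>
    have := f.map_rel r (x.map (fun _ => Quot.mk _)) ⟨x, ha, rfl⟩
    rw [Tup.map_map (Y := (frozen φ).carrier) (Z := X.carrier)] at this
    exact this

theorem frozen_hom_ext {X : Inst σ} {V : σ.Sorts → Type u} {φ : Set (Atom σ V)}
    {f g : frozen φ ⟶ X} (h : ∀ s x, frozenVal f s x = frozenVal g s x) : f = g :=
  Inst.hom_ext fun s x => by
    induction x using Quot.ind with
    | mk x => exact h s x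

/-- The inclusion of a summand into a coproduct. -/
def sigmaIncl {ι : Type u} (X : ι → Inst σ) (i : ι) : X i ⟶ sigmaInst X :=
  InstHom.mk (fun _ x => ⟨i, x⟩) (fun _ w hw => ⟨i, w, hw, rfl⟩)

theorem sigma_hom_ext {ι : Type u} {X : ι → Inst σ} {I : Inst σ} {f g : sigmaInst X ⟶ I}
    (h : ∀ i, sigmaIncl X i ≫ f = sigmaIncl X i ≫ g) : f = g :=
  Inst.hom_ext fun s x => Inst.congr_toFun (h x.1) s x.2

/-- The universal property of a parallel chase step, in terms of the individual triggers. -/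
theorem isParallelStep_iff {T : Theory σ} {I I' : Inst σ} (𝓕 : Set (Trigger T I)) (c : I ⟶ I') :
    IsParallelStep 𝓕 c ↔ ∃ g : ∀ t : 𝓕, (T.ax t.1.1).back ⟶ I',
      (∀ t, (T.ax t.1.1).frontToBack ≫ g t = t.1.2 ≫ c) ∧
      (∀ (X : Inst σ) (h : I ⟶ X) (k : ∀ t : 𝓕, (T.ax t.1.1).back ⟶ X),
        (∀ t, (T.ax t.1.1).frontToBack ≫ k t = t.1.2 ≫ h) →
        ∃ l : I' ⟶ X, c ≫ l = h ∧ ∀ t, g t ≫ l = k t) ∧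
      (∀ (X : Inst σ) (l l' : I' ⟶ X), c ≫ l = c ≫ l' → (∀ t, g t ≫ l = g t ≫ l') → l = l') := by
  constructor
  · rintro ⟨g, hg⟩
    refine ⟨fun t => sigmaIncl (fun t : 𝓕 => (T.ax t.1.1).back) t ≫ g, fun t => ?_, fun X h k hk => ?_, fun X l l' h h' => ?_⟩
    · exact (congrArg (fun m => sigmaIncl (fun t : 𝓕 => (T.ax t.1.1).front) t ≫ m) hg.w).symm
    · have w : sigmaDesc (fun t : 𝓕 => t.1.2) ≫ h =
          sigmaMap (fun t : 𝓕 => (T.ax t.1.1).frontToBack) ≫ sigmaDesc k :=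
        sigma_hom_ext fun t => (hk t).symm
      refine ⟨hg.desc h (sigmaDesc k) w, hg.inl_desc _ _ _, fun t => ?_⟩
      rw [Category.assoc, hg.inr_desc]
      rfl
    · exact hg.hom_ext h (sigma_hom_ext fun t => by simpa only [Category.assoc] using h' t)
  · rintro ⟨g, hg, ex, un⟩
    have w : sigmaDesc (fun t : 𝓕 => t.1.2) ≫ c =
        sigmaMap (fun t : 𝓕 => (T.ax t.1.1).frontToBack) ≫ sigmaDesc g :=
      sigma_hom_ext fun t => (hg t).symm
    -- A cocone under the span is the same as a morphism out of `I` with a compatible family of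
    -- extensions, one for each trigger.
    have ex' : ∀ s : Limits.PushoutCocone (sigmaDesc (fun t : 𝓕 => t.1.2))
        (sigmaMap (fun t : 𝓕 => (T.ax t.1.1).frontToBack)),
        ∃ l : I' ⟶ s.pt, c ≫ l = s.inl ∧ ∀ t, g t ≫ l = sigmaIncl (fun t : 𝓕 => (T.ax t.1.1).back) t ≫ s.inr := fun s =>
      ex s.pt s.inl (fun t => sigmaIncl (fun t : 𝓕 => (T.ax t.1.1).back) t ≫ s.inr) fun t =>
        (congrArg (fun m => sigmaIncl (fun t : 𝓕 => (T.ax t.1.1).front) t ≫ m) s.condition).symm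
    choose l hl hl' using ex'
    refine ⟨sigmaDesc g, ⟨⟨w⟩, ⟨Limits.PushoutCocone.IsColimit.mk _ l hl
      (fun s => sigma_hom_ext fun t => hl' s t) fun s m h₁ h₂ => ?_⟩⟩⟩
    refine un _ _ _ (h₁.trans (hl s).symm) fun t => ?_
    rw [hl' s t, ← h₂]
    rfl

/-! ### Invariance of triggers and chase steps under isomorphism -/

/-- The image of a trigger under a morphism of instances. -/
abbrev Trigger.push {T : Theory σ} {I I' : Inst σ} (t : Trigger T I) (e : I ⟶ I') : Trigger T I' :=
  ⟨t.1, t.2 ≫ e⟩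

theorem Trigger.isActive_push {T : Theory σ} {I I' : Inst σ} {t : Trigger T I} (e : I ≅ I')
    (ht : t.IsActive) : (t.push e.hom).IsActive := by
  rintro ⟨g, hg⟩
  refine ht ⟨g ≫ e.inv, ?_⟩
  rw [← Category.assoc, hg]
  simp

theorem activeTgds_push {T : Theory σ} {I I' : Inst σ} (e : I ≅ I') {t : Trigger T I}
    (ht : t ∈ activeTgds T I) : t.push e.hom ∈ activeTgds T I' :=
  ⟨ht.1, Trigger.isActive_push e ht.2⟩

theorem activeEgds_push {T : Theory σ} {I I' : Inst σ} (e : I ≅ I') {t : Trigger T I}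
    (ht : t ∈ activeEgds T I) : t.push e.hom ∈ activeEgds T I' :=
  ⟨ht.1, Trigger.isActive_push e ht.2⟩

theorem activeTgds_nonempty_of_iso {T : Theory σ} {I I' : Inst σ} (e : I ≅ I')
    (h : (activeTgds T I).Nonempty) : (activeTgds T I').Nonempty :=
  h.elim fun _ ht => ⟨_, activeTgds_push e ht⟩

theorem activeEgds_nonempty_of_iso {T : Theory σ} {I I' : Inst σ} (e : I ≅ I')
    (h : (activeEgds T I).Nonempty) : (activeEgds T I').Nonempty :=
  h.elim fun _ ht => ⟨_, activeEgds_push e ht⟩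

/-- Pushouts are unique up to isomorphism. The hypotheses `h` and `h'` say that `e` matches the two
sets of triggers, so each universal property applies to the other cocone. -/
theorem IsParallelStep.exists_hom {T : Theory σ} {I₁ I₂ I₁' I₂' : Inst σ}
    {𝓕₁ : Set (Trigger T I₁)} {𝓕₂ : Set (Trigger T I₂)} (e : I₁ ≅ I₂)
    (h : ∀ t ∈ 𝓕₁, t.push e.hom ∈ 𝓕₂) (h' : ∀ t ∈ 𝓕₂, t.push e.inv ∈ 𝓕₁)
    {c₁ : I₁ ⟶ I₁'} {c₂ : I₂ ⟶ I₂'}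
    (s₁ : IsParallelStep 𝓕₁ c₁) (s₂ : IsParallelStep 𝓕₂ c₂) :
    ∃ e' : I₁' ≅ I₂', c₁ ≫ e'.hom = e.hom ≫ c₂ := by
  obtain ⟨g₁, hg₁, ex₁, un₁⟩ := (isParallelStep_iff _ _).1 s₁
  obtain ⟨g₂, hg₂, ex₂, un₂⟩ := (isParallelStep_iff _ _).1 s₂
  obtain ⟨l, hl, hl'⟩ := ex₁ I₂' (e.hom ≫ c₂) (fun t => g₂ ⟨t.1.push e.hom, h _ t.2⟩)
    (fun t => (hg₂ ⟨t.1.push e.hom, h _ t.2⟩).trans (Category.assoc _ _ _))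
  obtain ⟨m, hm, hm'⟩ := ex₂ I₁' (e.inv ≫ c₁) (fun t => g₁ ⟨t.1.push e.inv, h' _ t.2⟩)
    (fun t => (hg₁ ⟨t.1.push e.inv, h' _ t.2⟩).trans (Category.assoc _ _ _))
  -- Pushing a trigger along `e.hom` and back along `e.inv` returns it only up to a propositional
  -- equality, while `g₁` takes the trigger as an index.
  have k₁ : ∀ (i : T.Index) (f f' : (T.ax i).front ⟶ I₁) (_ : f = f') (q : ⟨i, f⟩ ∈ 𝓕₁)
      (q' : ⟨i, f'⟩ ∈ 𝓕₁), g₁ ⟨⟨i, f⟩, q⟩ = g₁ ⟨⟨i, f'⟩, q'⟩ := by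
    rintro i f _ rfl q q'; rfl
  have k₂ : ∀ (i : T.Index) (f f' : (T.ax i).front ⟶ I₂) (_ : f = f') (q : ⟨i, f⟩ ∈ 𝓕₂)
      (q' : ⟨i, f'⟩ ∈ 𝓕₂), g₂ ⟨⟨i, f⟩, q⟩ = g₂ ⟨⟨i, f'⟩, q'⟩ := by
    rintro i f _ rfl q q'; rfl
  refine ⟨⟨l, m, un₁ _ _ _ ?_ fun t => ?_, un₂ _ _ _ ?_ fun t => ?_⟩, hl⟩
  · rw [← Category.assoc, hl, Category.assoc, hm]
    simp
  · rw [← Category.assoc, hl', hm' ⟨t.1.push e.hom, h _ t.2⟩, Category.comp_id]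
    exact k₁ _ _ _ (by simp [Trigger.push]) _ _
  · rw [← Category.assoc, hm, Category.assoc, hl]
    simp
  · rw [← Category.assoc, hm', hl' ⟨t.1.push e.inv, h' _ t.2⟩, Category.comp_id]
    exact k₂ _ _ _ (by simp [Trigger.push]) _ _

/-- Two configurations of the chase are isomorphic under the input. -/
def ChaseConfig.Equivalent {I₀ : Inst σ} (x y : ChaseConfig I₀) : Prop :=
  x.loc = y.loc ∧ ∃ e : x.cur ≅ y.cur, x.mor ≫ e.hom = y.mor

theorem ChaseConfig.Equivalent.refl {I₀ : Inst σ} (x : ChaseConfig I₀) : x.Equivalent x :=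
  ⟨rfl, Iso.refl _, Category.comp_id _⟩

theorem ChaseStep.loc_ne_done {T : Theory σ} {I₀ : Inst σ} {x x' : ChaseConfig I₀}
    (hx : ChaseStep T x x') : x.loc ≠ .done := by
  cases hx <;> simp

/-- The fast parallel chase is deterministic up to isomorphism under the input. -/
theorem ChaseStep.equivalent {T : Theory σ} {I₀ : Inst σ} {x y x' y' : ChaseConfig I₀}
    (h : x.Equivalent y) (hx : ChaseStep T x x') (hy : ChaseStep T y y') : x'.Equivalent y' := by
  obtain ⟨hl, e, he⟩ := h
  cases hx with
  | tgds first i c guard step =>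
    cases hy with
    | tgds first' i' c' guard' step' =>
      obtain ⟨e', he'⟩ := step.exists_hom e (fun t => activeTgds_push e)
        (fun t => activeTgds_push e.symm) step'
      refine ⟨rfl, e', ?_⟩
      change i ≫ e.hom = i' at he
      change (i ≫ c) ≫ e'.hom = i' ≫ c'
      rw [Category.assoc, he', ← he, Category.assoc]
    | egds => simp at hl
    | exitInner => simp at hl
    -- Equal control points force `first = false`, so the left guard provides an active trigger; its
    -- image under `e` contradicts the right guard.
    | exitOuter i' guard' =>
      simp only [Loc.outer.injEq] at hl
      subst hl
      simp only [Bool.false_eq_true, or_false] at guard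
      exact absurd (activeTgds_nonempty_of_iso e guard) guard'
  | egds i c guard step =>
    cases hy with
    | tgds => simp at hl
    | egds i' c' guard' step' =>
      obtain ⟨e', he'⟩ := step.exists_hom e (fun t => activeEgds_push e)
        (fun t => activeEgds_push e.symm) step'
      refine ⟨rfl, e', ?_⟩
      change i ≫ e.hom = i' at he
      change (i ≫ c) ≫ e'.hom = i' ≫ c'
      rw [Category.assoc, he', ← he, Category.assoc]
    | exitInner i' guard' => exact absurd (activeEgds_nonempty_of_iso e guard) guard'
    | exitOuter => simp at hl
  | exitInner i guard =>
    cases hy with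
    | tgds => simp at hl
    | egds i' c' guard' step' => exact absurd (activeEgds_nonempty_of_iso e.symm guard') guard
    | exitInner => exact ⟨rfl, e, he⟩
    | exitOuter => simp at hl
  | exitOuter i guard =>
    cases hy with
    | tgds first' i' c' guard' step' =>
      simp only [Loc.outer.injEq] at hl
      subst hl
      simp only [Bool.false_eq_true, or_false] at guard'
      exact absurd (activeTgds_nonempty_of_iso e.symm guard') guard
    | egds => simp at hl
    | exitInner => simp at hl
    | exitOuter => exact ⟨rfl, e, he⟩

end Instances

/-! ### Instances on the signature of a presentation -/

section Presentation

variable {P : CatPres.{u}}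

/-- The binary relation by which an instance interprets a generating morphism. -/
def Inst.Edge (X : Inst P.signature) {a b : P.Ob} (f : a ⟶ b) (x : X.carrier a)
    (y : X.carrier b) : Prop :=
  X.rel ⟨a, b, f⟩ (x, y, PUnit.unit)

/-- The ends of the chains along a path that start at `x`. -/
def Inst.eval (X : Inst P.signature) {a : P.Ob} (x : X.carrier a) :
    ∀ {b : P.Ob}, Quiver.Path a b → Set (X.carrier b)
  | _, .nil => {x}
  | _, .cons p f => {z | ∃ y ∈ X.eval x p, X.Edge f y z}

/-- A morphism of instances from functions that preserve the binary relations. -/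
def Inst.homMk {X Y : Inst P.signature} (h : ∀ a : P.Ob, X.carrier a → Y.carrier a)
    (hh : ∀ (a b : P.Ob) (f : a ⟶ b) x y, X.Edge f x y → Y.Edge f (h a x) (h b y)) : X ⟶ Y :=
  InstHom.mk h (by
    rintro ⟨a, b, f⟩ ⟨x, y, ⟨⟩⟩ hxy
    exact hh a b f x y hxy)

theorem Inst.edge_map {X Y : Inst P.signature} (h : X ⟶ Y) {a b : P.Ob} (f : a ⟶ b)
    {x : X.carrier a} {y : X.carrier b} (hxy : X.Edge f x y) :
    Y.Edge f (h.toFun a x) (h.toFun b y) :=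
  h.map_rel ⟨a, b, f⟩ _ hxy

/-- Eliminator for families with a single variable. -/
def OneVar.elim {Q : Type u} {a : Q} {X : Q → Type u} (x : X a) : ∀ s, OneVar a s → X s
  | _, .mk => x

theorem endVar_mem_eval (X : Inst P.signature) {V : P.Ob → Type u} (v : ∀ s, V s → X.carrier s)
    {a b : P.Ob} (x : V a) (p : Quiver.Path a b) (y : ∀ t, PathVar p t → V t)
    (h : ∀ A ∈ pathAtoms P x p y, A.Holds X v) :
    v b (endVar x p y) ∈ X.eval (v a x) p := by
  induction p with
  | nil => exact rfl
  | cons p e ih =>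
    have h₁ := ih (fun t z => y t (.older p e z)) fun A hA => h A (Set.mem_insert_of_mem _ hA)
    exact ⟨v _ (endVar x p fun t z => y t (.older p e z)), h₁, h _ (Set.mem_insert _ _)⟩

/-- Converse of `endVar_mem_eval`. The chain `z` is fixed before the family `V` of variables, so
that the chains along both sides of an equation can later be merged into one assignment; the
induction also needs this freedom. -/
theorem exists_chain_of_mem_eval (X : Inst P.signature) {a b : P.Ob} (u : X.carrier a)
    (p : Quiver.Path a b) (w : X.carrier b) (hw : w ∈ X.eval u p) :
    ∃ z : ∀ t, PathVar p t → X.carrier t, ∀ (V : P.Ob → Type u) (v : ∀ s, V s → X.carrier s)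
      (x : V a) (y : ∀ t, PathVar p t → V t), v a x = u → (∀ t q, v t (y t q) = z t q) →
      v b (endVar x p y) = w ∧ ∀ A ∈ pathAtoms P x p y, A.Holds X v := by
  induction p with
  | nil =>
    refine ⟨fun t q => (nomatch q), fun V v x y hx _ => ⟨hx.trans (Eq.symm hw), fun A hA => hA.elim⟩⟩
  | @cons b c p e ih =>
    obtain ⟨w', hw', he⟩ := hw
    obtain ⟨z, hz⟩ := ih w' hw'
    let z' : ∀ t, PathVar (p.cons e) t → X.carrier t := fun t q =>
      match t, q with
      | _, .last _ _ => w
      | t, .older _ _ q => z t q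
    refine ⟨z', fun V v x y hx hy => ?_⟩
    obtain ⟨h₁, h₂⟩ := hz V v x (fun t q => y t (.older p e q)) hx (fun t q => hy t _)
    refine ⟨hy _ (.last p e), ?_⟩
    rintro A (rfl | hA)
    · have := hy _ (.last p e)
      change X.Edge e (v _ (endVar x p fun t q => y t (.older p e q))) (v _ (y _ (.last p e)))
      rw [h₁, this]
      exact he
    · exact h₂ A hA

/-- The pairs of elements that an egd of the theory of `P` identifies. -/
inductive Inst.Forced (X : Inst P.signature) : ∀ a : P.Ob, X.carrier a → X.carrier a → Prop
  | eqn {a b : P.Ob} (p q : Quiver.Path a b) (h : P.eqn p q) (u : X.carrier a)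
      (v v' : X.carrier b) (hv : v ∈ X.eval u p) (hv' : v' ∈ X.eval u q) : Forced X b v v'
  | functional {a b : P.Ob} (f : a ⟶ b) (u : X.carrier a) (v v' : X.carrier b)
      (hv : X.Edge f u v) (hv' : X.Edge f u v') : Forced X b v v'

/-- The elements at which a generating morphism with target `b` is undefined. -/
structure Inst.Missing (X : Inst P.signature) (b : P.Ob) : Type u where
  src : P.Ob
  gen : src ⟶ b
  elt : X.carrier src
  undefined : ¬ ∃ v, X.Edge gen elt v

/-! ### Egds of a presentation: triggers, forced pairs, quotients -/

theorem not_isEgd_totalAxiom {a b : P.Ob} (f : a ⟶ b) : ¬ (totalAxiom P f).IsEgd := by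
  intro h
  obtain ⟨s, x, y, hxy⟩ := h _ (Set.mem_singleton _)
  cases hxy

theorem isTgd_totalAxiom {a b : P.Ob} (f : a ⟶ b) : (totalAxiom P f).IsTgd := by
  rintro A rfl
  exact ⟨_, _, rfl⟩

theorem isEgd_eqnAxiom {a b : P.Ob} (p q : Quiver.Path a b) : (eqnAxiom P p q).IsEgd := by
  rintro A rfl
  exact ⟨_, _, _, rfl⟩

theorem not_isTgd_eqnAxiom {a b : P.Ob} (p q : Quiver.Path a b) :
    ¬ (eqnAxiom P p q).IsTgd := by
  intro h
  obtain ⟨s, x, hx⟩ := h _ (Set.mem_singleton _)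
  cases hx

theorem isEgd_uniqueness {σ : Signature.{u}} (ξ : Sequent σ) : ξ.uniqueness.IsEgd := by
  rintro A ⟨w, rfl⟩
  exact ⟨_, _, _, rfl⟩

theorem not_isTgd_uniqueness_totalAxiom {a b : P.Ob} (f : a ⟶ b) :
    ¬ (totalAxiom P f).uniqueness.IsTgd := by
  intro h
  obtain ⟨s, x, hx⟩ := h _ ⟨⟨b, OneVar.mk⟩, rfl⟩
  cases hx

/-- For a sequent without existential variables, extensions along `front ⟶ back` are unique. -/
theorem Sequent.back_hom_ext {σ : Signature.{u}} {ξ : Sequent σ} (hW : ∀ s, IsEmpty (ξ.W s))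
    {X : Inst σ} {k k' : ξ.back ⟶ X} (h : ξ.frontToBack ≫ k = ξ.frontToBack ≫ k') : k = k' := by
  refine frozen_hom_ext fun s x => ?_
  rcases x with x | x
  · exact Inst.congr_toFun h s (Quot.mk _ x)
  · exact (hW s).elim x

/-- An extension along `front ⟶ back`, for a sequent without existential variables. -/
theorem Sequent.exists_back_hom {σ : Signature.{u}} {ξ : Sequent σ} (hW : ∀ s, IsEmpty (ξ.W s))
    {X : Inst σ} (m : ξ.front ⟶ X)
    (h : ∀ A ∈ ξ.ψ, A.Holds X (fun s => Sum.elim (frozenVal m s) (fun w => (hW s).elim w))) :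
    ∃ k : ξ.back ⟶ X, ξ.frontToBack ≫ k = m := by
  refine ⟨frozenDesc (fun s => Sum.elim (frozenVal m s) (fun w => (hW s).elim w)) ?_, ?_⟩
  · rintro A (⟨B, hB, rfl⟩ | hA)
    · rw [Atom.holds_map]
      exact frozenVal_holds m B hB
    · exact h A hA
  · exact frozen_hom_ext fun s x => rfl

/-- Only totality axioms have existential variables, and they are not egds. Extensions of egd
triggers along `front ⟶ back` are therefore unique. -/
theorem isEmpty_W_of_isEgd (i : P.theory.toRegular.Index) (hi : (P.theory.toRegular.ax i).IsEgd)
    (s : P.Ob) : IsEmpty ((P.theory.toRegular.ax i).W s) := by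
  rcases i with (f | ⟨p, q, h⟩) | i
  · exact absurd hi (not_isEgd_totalAxiom f)
  · exact inferInstanceAs (IsEmpty PEmpty)
  · exact inferInstanceAs (IsEmpty PEmpty)

/-- If a morphism identifies all forced pairs, the egd triggers composed with it are inactive. -/
theorem exists_extension_of_forced {X Y : Inst P.signature} (h : X ⟶ Y)
    (hh : ∀ a x y, X.Forced a x y → h.toFun a x = h.toFun a y)
    (t : Trigger P.theory.toRegular X) (ht : (P.theory.toRegular.ax t.1).IsEgd) :
    ∃ k, (P.theory.toRegular.ax t.1).frontToBack ≫ k = t.2 ≫ h := by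
  refine Sequent.exists_back_hom (isEmpty_W_of_isEgd _ ht) _ ?_
  obtain ⟨(@⟨a, b, f⟩ | @⟨a, b, p, q, e⟩) | (@⟨a, b, f⟩ | @⟨a, b, p, q, e⟩), m⟩ := t
  · exact absurd ht (not_isEgd_totalAxiom f)
  · rintro A rfl
    change frozen (eqnAxiom P p q).φ ⟶ X at m
    have key := frozenVal_holds m
    exact hh _ _ _ (Inst.Forced.eqn p q e (frozenVal m a .source) _ _
      (endVar_mem_eval X (frozenVal m) EqnVar.source p _ fun A hA => key A (Or.inl hA))
      (endVar_mem_eval X (frozenVal m) EqnVar.source q _ fun A hA => key A (Or.inr hA)))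
  · rintro A ⟨⟨_, ⟨⟩⟩, rfl⟩
    change frozen (totalAxiom P f).uniqueness.φ ⟶ X at m
    have key := frozenVal_holds m
    exact hh _ _ _ (Inst.Forced.functional f (frozenVal m a (Sum.inl .mk)) _ _
      (key _ (Or.inr (Or.inl ⟨_, rfl, rfl⟩))) (key _ (Or.inr (Or.inr ⟨_, rfl, rfl⟩))))
  -- An equation axiom has no existential variables, so its uniqueness egd has an empty conclusion.
  · rintro A ⟨⟨_, ⟨⟩⟩, rfl⟩

/-- The two elements of a nontrivial forced pair are identified by an active egd trigger. -/
theorem Inst.Forced.exists_active {X : Inst P.signature} {b : P.Ob} {x y : X.carrier b}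
    (hxy : X.Forced b x y) (hne : x ≠ y) :
    ∃ t ∈ activeEgds P.theory.toRegular X, ∀ (Y : Inst P.signature) (h : X ⟶ Y)
      (k : (P.theory.toRegular.ax t.1).back ⟶ Y),
      (P.theory.toRegular.ax t.1).frontToBack ≫ k = t.2 ≫ h → h.toFun b x = h.toFun b y := by
  -- Activity comes for free: if the trigger extended over `X` itself, the identity would have to
  -- identify `x` and `y`.
  suffices hs : ∃ t : Trigger P.theory.toRegular X, (P.theory.toRegular.ax t.1).IsEgd ∧
      ∀ (Y : Inst P.signature) (h : X ⟶ Y) (k : (P.theory.toRegular.ax t.1).back ⟶ Y),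
      (P.theory.toRegular.ax t.1).frontToBack ≫ k = t.2 ≫ h → h.toFun b x = h.toFun b y by
    obtain ⟨t, ht, H⟩ := hs
    refine ⟨t, ⟨ht, ?_⟩, H⟩
    rintro ⟨k, hk⟩
    exact hne (H X (𝟙 X) k (hk.trans (Category.comp_id _).symm))
  cases hxy with
  | @eqn a _ p q h u v v' hv hv' =>
    obtain ⟨z, hz⟩ := exists_chain_of_mem_eval X u p x hv
    obtain ⟨z', hz'⟩ := exists_chain_of_mem_eval X u q y hv'
    -- The two chains are glued at their common source `u`.
    let val : ∀ s, EqnVar p q s → X.carrier s := fun s e =>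
      match s, e with
      | _, .source => u
      | s, .left r => z s r
      | s, .right r => z' s r
    obtain ⟨h₁, h₂⟩ := hz (EqnVar p q) val .source (fun _ => .left) rfl (fun _ _ => rfl)
    obtain ⟨h₁', h₂'⟩ := hz' (EqnVar p q) val .source (fun _ => .right) rfl (fun _ _ => rfl)
    let m : (eqnAxiom P p q).front ⟶ X :=
      frozenDesc val (fun A hA => hA.elim (h₂ A) (h₂' A))
    refine ⟨⟨.inl (.eqn p q h), m⟩, isEgd_eqnAxiom p q, fun Y l k hk => ?_⟩
    change (eqnAxiom P p q).back ⟶ Y at k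
    change (eqnAxiom P p q).frontToBack ≫ k = m ≫ l at hk
    have key := frozenVal_holds k _ (Or.inr rfl)
    have e₁ := Inst.congr_toFun hk _
      (Quot.mk _ (endVar (V := EqnVar p q) EqnVar.source p (fun _ => EqnVar.left)))
    have e₂ := Inst.congr_toFun hk _
      (Quot.mk _ (endVar (V := EqnVar p q) EqnVar.source q (fun _ => EqnVar.right)))
    rw [← h₁, ← h₁']
    exact e₁.symm.trans (key.trans e₂)
  | @functional a _ f u v v' hv hv' =>
    let val : ∀ s, OneVar (Q := P.Ob) a s ⊕ (OneVar (Q := P.Ob) b s ⊕ OneVar (Q := P.Ob) b s) →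
        X.carrier s := fun s => Sum.elim (OneVar.elim u s)
      (Sum.elim (OneVar.elim x s) (OneVar.elim y s))
    let m : (totalAxiom P f).uniqueness.front ⟶ X := frozenDesc val (by
      rintro A (⟨B, hB, rfl⟩ | ⟨B, rfl, rfl⟩ | ⟨B, rfl, rfl⟩)
      · exact hB.elim
      · exact hv
      · exact hv')
    refine ⟨⟨.inr (.total f), m⟩, isEgd_uniqueness _, fun Y l k hk => ?_⟩
    change (totalAxiom P f).uniqueness.back ⟶ Y at k
    change (totalAxiom P f).uniqueness.frontToBack ≫ k = m ≫ l at hk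
    have key := frozenVal_holds k _ (Or.inr ⟨⟨b, OneVar.mk⟩, rfl⟩)
    have e₁ := Inst.congr_toFun hk b (Quot.mk _ (Sum.inr (Sum.inl .mk)))
    have e₂ := Inst.congr_toFun hk b (Quot.mk _ (Sum.inr (Sum.inr .mk)))
    exact e₁.symm.trans (key.trans e₂)

/-- If all forced pairs are trivial, the identity of `X` satisfies the hypothesis of
`exists_extension_of_forced`, so no egd trigger is active. -/
theorem activeEgds_nonempty_iff {X : Inst P.signature} :
    (activeEgds P.theory.toRegular X).Nonempty ↔ ∃ a x y, X.Forced a x y ∧ x ≠ y := by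
  constructor
  · rintro ⟨t, ht, hact⟩
    by_contra! hno
    refine hact ?_
    obtain ⟨k, hk⟩ := exists_extension_of_forced (𝟙 X) (fun a x y hxy => hno a x y hxy) t ht
    exact ⟨k, hk.trans (Category.comp_id _)⟩
  · rintro ⟨a, x, y, hxy, hne⟩
    obtain ⟨t, ht, -⟩ := hxy.exists_active hne
    exact ⟨t, ht⟩

/-- The quotient by the equivalence relation generated by the forced pairs is the parallel chase
step with all active egd triggers. -/
theorem isParallelStep_activeEgds {X X' : Inst P.signature} (c : X ⟶ X')
    (surj : ∀ a : P.Ob, Function.Surjective (c.toFun a))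
    (rel : ∀ (a b : P.Ob) (f : a ⟶ b) x y, X'.Edge f x y →
      ∃ u v, X.Edge f u v ∧ c.toFun a u = x ∧ c.toFun b v = y)
    (forced : ∀ a x y, X.Forced a x y → c.toFun a x = c.toFun a y)
    (ker : ∀ a x y, c.toFun a x = c.toFun a y → Relation.EqvGen (X.Forced a) x y) :
    IsParallelStep (activeEgds P.theory.toRegular X) c := by
  rw [isParallelStep_iff]
  have ex := fun t : activeEgds P.theory.toRegular X =>
    exists_extension_of_forced c forced t.1 t.2.1
  choose g hg using ex
  refine ⟨g, hg, fun Y h k hk => ?_, fun Y l l' hl _ => ?_⟩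
  -- A morphism compatible with the active triggers identifies all forced pairs: the nontrivial ones
  -- come from active triggers, and the others need no trigger.
  · have hker : ∀ a x y, c.toFun a x = c.toFun a y → h.toFun a x = h.toFun a y := by
      intro a x y hxy
      induction ker a x y hxy with
      | rel x y hf =>
        by_cases hne : x = y
        · rw [hne]
        · obtain ⟨t, ht, H⟩ := hf.exists_active hne
          exact H Y h (k ⟨t, ht⟩) (hk ⟨t, ht⟩)
      | refl x => rfl
      | symm x y _ ih => exact (ih hxy.symm).symm
      | trans x y z hxy' hyz' ih₁ ih₂ =>
        -- The induction carries the equality in `X'` as a premise, so the middle element of a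
        -- transitivity step needs its own equalities.
        have aux : ∀ x y, Relation.EqvGen (X.Forced a) x y → c.toFun a x = c.toFun a y := by
          intro x y hxy
          induction hxy with
          | rel x y hf => exact forced _ _ _ hf
          | refl x => rfl
          | symm x y _ ih => exact ih.symm
          | trans x y z _ _ ih₁ ih₂ => exact ih₁.trans ih₂
        exact (ih₁ (aux _ _ hxy')).trans (ih₂ (aux _ _ hyz'))
    -- The factorization is `h` composed with a section `r` of `c`; by `hker` it does not depend on
    -- the section.
    choose r hr using surj
    have hrc : ∀ a x, h.toFun a (r a (c.toFun a x)) = h.toFun a x := fun a x =>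
      hker a _ _ (hr a _)
    let l : X' ⟶ Y := Inst.homMk (fun a y => h.toFun a (r a y)) (by
      intro a b f x y hxy
      obtain ⟨u, v, huv, rfl, rfl⟩ := rel a b f x y hxy
      rw [hrc, hrc]
      exact Inst.edge_map h f huv)
    have hl : c ≫ l = h := Inst.hom_ext fun a x => hrc a x
    refine ⟨l, hl, fun t => Sequent.back_hom_ext (isEmpty_W_of_isEgd _ t.2.1) ?_⟩
    rw [hk t, ← Category.assoc, hg t, Category.assoc, hl]
  · refine Inst.hom_ext fun a y => ?_
    obtain ⟨x, rfl⟩ := surj a y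
    exact Inst.congr_toFun hl a x

/-! ### Tgds of a presentation: missing values and free extensions -/

/-- The trigger of the totality axiom of a generating morphism at an element. -/
def totalTrigger (X : Inst P.signature) {a b : P.Ob} (f : a ⟶ b) (u : X.carrier a) :
    Trigger P.theory.toRegular X :=
  ⟨.inl (.total f), frozenDesc (φ := (totalAxiom P f).φ) (OneVar.elim u) fun _ h => h.elim⟩

/-- The morphism out of `back` of a totality axiom given by a related pair. -/
def totalBack {X : Inst P.signature} {a b : P.Ob} (f : a ⟶ b) (u : X.carrier a) (v : X.carrier b)
    (h : X.Edge f u v) : (totalAxiom P f).back ⟶ X :=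
  frozenDesc (fun s => Sum.elim (OneVar.elim u s) (OneVar.elim v s)) (by
    rintro A (⟨B, hB, rfl⟩ | rfl)
    · exact hB.elim
    · exact h)

theorem totalFront_hom_ext {X : Inst P.signature} {a b : P.Ob} {f : a ⟶ b}
    {k k' : (totalAxiom P f).front ⟶ X}
    (h : frozenVal k a .mk = frozenVal k' a .mk) : k = k' :=
  frozen_hom_ext (by rintro _ ⟨⟩; exact h)

theorem totalBack_hom_ext {X : Inst P.signature} {a b : P.Ob} {f : a ⟶ b}
    {k k' : (totalAxiom P f).back ⟶ X}
    (h : frozenVal k a (Sum.inl .mk) = frozenVal k' a (Sum.inl .mk))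
    (h' : frozenVal k b (Sum.inr .mk) = frozenVal k' b (Sum.inr .mk)) : k = k' :=
  frozen_hom_ext (by
    rintro _ (⟨⟨⟩⟩ | ⟨⟨⟩⟩)
    · exact h
    · exact h')

theorem totalBack_edge {X : Inst P.signature} {a b : P.Ob} {f : a ⟶ b}
    (k : (totalAxiom P f).back ⟶ X) :
    X.Edge f (frozenVal k a (Sum.inl .mk)) (frozenVal k b (Sum.inr .mk)) :=
  frozenVal_holds k _ (Or.inr rfl)

theorem totalTrigger_mem_activeTgds {X : Inst P.signature} {a b : P.Ob} (f : a ⟶ b)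
    (u : X.carrier a) (h : ¬ ∃ v, X.Edge f u v) :
    totalTrigger X f u ∈ activeTgds P.theory.toRegular X := by
  refine ⟨isTgd_totalAxiom f, ?_⟩
  rintro ⟨k, hk⟩
  have e := Inst.congr_toFun hk a (Quot.mk _ .mk)
  have := totalBack_edge k
  exact h ⟨_, (show frozenVal k a (Sum.inl .mk) = u from e) ▸ this⟩

/-- The uniqueness sequent of an equation has an empty conclusion and is therefore vacuously a tgd
as well, but its triggers always extend. Only totality axioms remain. -/
theorem eq_totalTrigger_of_mem_activeTgds {X : Inst P.signature}
    {t : Trigger P.theory.toRegular X} (ht : t ∈ activeTgds P.theory.toRegular X) :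
    ∃ (a b : P.Ob) (f : a ⟶ b) (u : X.carrier a), (¬ ∃ v, X.Edge f u v) ∧
      t = totalTrigger X f u := by
  obtain ⟨(@⟨a, b, f⟩ | @⟨a, b, p, q, e⟩) | (@⟨a, b, f⟩ | @⟨a, b, p, q, e⟩), m⟩ := t
  · change (totalAxiom P f).front ⟶ X at m
    refine ⟨a, b, f, frozenVal m a .mk, ?_, ?_⟩
    · rintro ⟨v, hv⟩
      exact ht.2 ⟨totalBack f _ v hv, totalFront_hom_ext rfl⟩
    · have : m = (totalTrigger X f (frozenVal m a .mk)).2 := totalFront_hom_ext rfl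
      exact congrArg (Sigma.mk _) this
  · exact absurd ht.1 (not_isTgd_eqnAxiom p q)
  · exact absurd ht.1 (not_isTgd_uniqueness_totalAxiom f)
  · refine absurd (Sequent.exists_back_hom (fun s => inferInstanceAs (IsEmpty PEmpty)) m ?_) ht.2
    rintro A ⟨⟨_, ⟨⟩⟩, rfl⟩

theorem activeTgds_nonempty_iff {X : Inst P.signature} :
    (activeTgds P.theory.toRegular X).Nonempty ↔
      ∃ (a b : P.Ob) (f : a ⟶ b) (u : X.carrier a), ¬ ∃ v, X.Edge f u v := by
  constructor
  · rintro ⟨t, ht⟩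
    obtain ⟨a, b, f, u, h, -⟩ := eq_totalTrigger_of_mem_activeTgds ht
    exact ⟨a, b, f, u, h⟩
  · rintro ⟨a, b, f, u, h⟩
    exact ⟨_, totalTrigger_mem_activeTgds f u h⟩

/-- Adding one fresh element for each missing value is the parallel chase step with all active tgd
triggers. -/
theorem isParallelStep_activeTgds {X X' : Inst P.signature} (c : X ⟶ X')
    (new : ∀ b : P.Ob, X.Missing b → X'.carrier b)
    (edge : ∀ (b : P.Ob) (m : X.Missing b), X'.Edge m.gen (c.toFun m.src m.elt) (new b m))
    (bij : ∀ b : P.Ob, Function.Bijective (Sum.elim (c.toFun b) (new b)))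
    (rel : ∀ (a b : P.Ob) (f : a ⟶ b) x y, X'.Edge f x y →
      (∃ u v, X.Edge f u v ∧ c.toFun a u = x ∧ c.toFun b v = y) ∨
      ∃ u h, c.toFun a u = x ∧ new b ⟨a, f, u, h⟩ = y) :
    IsParallelStep (activeTgds P.theory.toRegular X) c := by
  rw [isParallelStep_iff]
  have ex : ∃ g : ∀ t : activeTgds P.theory.toRegular X, (P.theory.toRegular.ax t.1.1).back ⟶ X',
      ∀ (a b : P.Ob) (f : a ⟶ b) (u : X.carrier a) (h : ¬ ∃ v, X.Edge f u v),
        g ⟨_, totalTrigger_mem_activeTgds f u h⟩ =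
          totalBack f (c.toFun a u) (new b ⟨a, f, u, h⟩) (edge b ⟨a, f, u, h⟩) := by
    -- The source of `g t` depends on `t`, which is only propositionally a totality trigger; hence
    -- the heterogeneous equality. The trigger determines `f` by its index and `u` by its value at
    -- the single variable, so the specification is consistent.
    have : ∀ t : activeTgds P.theory.toRegular X,
        ∃ g : (P.theory.toRegular.ax t.1.1).back ⟶ X',
        ∀ (a b : P.Ob) (f : a ⟶ b) (u : X.carrier a) (h : ¬ ∃ v, X.Edge f u v),
          t.1 = totalTrigger X f u → g ≍
            totalBack f (c.toFun a u) (new b ⟨a, f, u, h⟩) (edge b ⟨a, f, u, h⟩) := by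
      rintro ⟨t, ht⟩
      obtain ⟨a, b, f, u, h, rfl⟩ := eq_totalTrigger_of_mem_activeTgds ht
      refine ⟨totalBack f (c.toFun a u) (new b ⟨a, f, u, h⟩) (edge b ⟨a, f, u, h⟩), ?_⟩
      intro a' b' f' u' h' e
      have e₁ : AxiomIndex.total f = AxiomIndex.total f' := Sum.inl.inj (congrArg Sigma.fst e)
      cases e₁
      have e₂ : (totalTrigger X f u).2 = (totalTrigger X f u').2 := eq_of_heq (Sigma.mk.inj e).2
      have e₃ : u = u' := Inst.congr_toFun e₂ a (Quot.mk _ .mk)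
      subst e₃
      rfl
    choose g hg using this
    exact ⟨g, fun a b f u h => eq_of_heq (hg _ a b f u h rfl)⟩
  obtain ⟨g, hg⟩ := ex
  refine ⟨g, ?_, fun Y h k hk => ?_, fun Y l l' hl hl' => ?_⟩
  · rintro ⟨t, ht⟩
    obtain ⟨a, b, f, u, h, rfl⟩ := eq_totalTrigger_of_mem_activeTgds ht
    rw [hg _ _ _ _ h]
    exact totalFront_hom_ext rfl
  -- The fresh element must go to the value that the extension `k` of its trigger assigns to the
  -- existential variable.
  · let val : ∀ b : P.Ob, X.Missing b → Y.carrier b := fun b m =>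
      frozenVal (k ⟨_, totalTrigger_mem_activeTgds m.gen m.elt m.undefined⟩) b (Sum.inr .mk)
    have hval : ∀ (b : P.Ob) (m : X.Missing b), Y.Edge m.gen (h.toFun m.src m.elt) (val b m) := by
      intro b m
      have e := Inst.congr_toFun (hk ⟨_, totalTrigger_mem_activeTgds m.gen m.elt m.undefined⟩)
        m.src (Quot.mk _ .mk)
      have := totalBack_edge (k ⟨_, totalTrigger_mem_activeTgds m.gen m.elt m.undefined⟩)
      exact (show frozenVal (k ⟨_, totalTrigger_mem_activeTgds m.gen m.elt m.undefined⟩) m.src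
        (Sum.inl .mk) = h.toFun m.src m.elt from e) ▸ this
    let L : ∀ b : P.Ob, X'.carrier b → Y.carrier b := fun b y =>
      Sum.elim (h.toFun b) (val b) ((Equiv.ofBijective _ (bij b)).symm y)
    have L₁ : ∀ b x, L b (c.toFun b x) = h.toFun b x := fun b x => by
      have := (Equiv.ofBijective _ (bij b)).symm_apply_apply (Sum.inl x)
      exact congrArg (Sum.elim (h.toFun b) (val b)) this
    have L₂ : ∀ b m, L b (new b m) = val b m := fun b m => by
      have := (Equiv.ofBijective _ (bij b)).symm_apply_apply (Sum.inr m)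
      exact congrArg (Sum.elim (h.toFun b) (val b)) this
    refine ⟨Inst.homMk L ?_, Inst.hom_ext L₁, ?_⟩
    · intro a b f x y hxy
      obtain ⟨u, v, huv, rfl, rfl⟩ | ⟨u, hu, rfl, rfl⟩ := rel a b f x y hxy
      · rw [L₁, L₁]
        exact Inst.edge_map h f huv
      · rw [L₁, L₂]
        exact hval b ⟨a, f, u, hu⟩
    · rintro ⟨t, ht⟩
      obtain ⟨a, b, f, u, hu, rfl⟩ := eq_totalTrigger_of_mem_activeTgds ht
      rw [hg _ _ _ _ hu]
      refine totalBack_hom_ext ?_ ?_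
      · exact (L₁ a u).trans
          (Inst.congr_toFun (hk ⟨_, ht⟩) a (Quot.mk _ .mk)).symm
      · exact L₂ b ⟨a, f, u, hu⟩
  · refine Inst.hom_ext fun b y => ?_
    obtain ⟨x | m, rfl⟩ := (bij b).2 y
    · exact Inst.congr_toFun hl b x
    · have := hl' ⟨_, totalTrigger_mem_activeTgds m.gen m.elt m.undefined⟩
      rw [hg _ _ _ _ m.undefined] at this
      exact Inst.congr_toFun this b (Quot.mk _ (Sum.inr .mk))

end Presentation

/-! ### The instance of a state of the fast left Kan algorithm -/

section States

variable {C D : CatPres.{u}} {F : PresMor C D} {I : Algebra C}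

theorem KanState.eval_comp (s : KanState F I) {d d' d'' : D.Ob} (u : s.J d)
    (p : Quiver.Path d d') (q : Quiver.Path d' d'') (w : s.J d'') :
    w ∈ s.eval u (p.comp q) ↔ ∃ v ∈ s.eval u p, w ∈ s.eval v q := by
  induction q with
  | nil =>
    constructor
    · exact fun h => ⟨w, h, rfl⟩
    · rintro ⟨v, h, rfl⟩
      exact h
  | cons q e ih =>
    constructor
    · rintro ⟨w', hw', he⟩
      obtain ⟨v, hv, hv'⟩ := (ih w').1 hw'
      exact ⟨v, hv, w', hv', he⟩
    · rintro ⟨v, hv, w', hv', he⟩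
      exact ⟨w', (ih w').2 ⟨v, hv, hv'⟩, he⟩

theorem Inst.eval_comp {P : CatPres.{u}} (X : Inst P.signature) {a b c : P.Ob} (u : X.carrier a)
    (p : Quiver.Path a b) (q : Quiver.Path b c) (w : X.carrier c) :
    w ∈ X.eval u (p.comp q) ↔ ∃ v ∈ X.eval u p, w ∈ X.eval v q := by
  induction q with
  | nil =>
    constructor
    · exact fun h => ⟨w, h, rfl⟩
    · rintro ⟨v, h, rfl⟩
      exact h
  | cons q e ih =>
    constructor
    · rintro ⟨w', hw', he⟩
      obtain ⟨v, hv, hv'⟩ := (ih w').1 hw'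
      exact ⟨v, hv, w', hv', he⟩
    · rintro ⟨v, hv, w', hv', he⟩
      exact ⟨w', (ih w').2 ⟨v, hv, hv'⟩, he⟩

theorem Inst.eval_toPath {P : CatPres.{u}} (X : Inst P.signature) {a b : P.Ob} (u : X.carrier a)
    (f : a ⟶ b) (w : X.carrier b) : w ∈ X.eval u f.toPath ↔ X.Edge f u w := by
  constructor
  · rintro ⟨v, rfl, h⟩
    exact h
  · exact fun h => ⟨u, rfl, h⟩

theorem KanState.toInst_eval_inr (s : KanState F I) {d d' : D.Ob} (u : s.J d)
    (p : Quiver.Path d d') (w : s.J d') :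
    w ∈ Inst.eval (P := cograph F) s.toInst (a := (cogInr F).obj d) u ((cogInr F).mapPath p) ↔
      w ∈ s.eval u p := by
  induction p with
  | nil => exact Iff.rfl
  | cons p g ih =>
    constructor
    · rintro ⟨v, hv, h⟩
      exact ⟨v, (ih v).1 hv, h⟩
    · rintro ⟨v, hv, h⟩
      exact ⟨v, (ih v).2 hv, h⟩

theorem KanState.toInst_eval_inl (s : KanState F I) {c c' : C.Ob} (u : I.obj c)
    (p : Quiver.Path c c') (w : I.obj c') :
    w ∈ Inst.eval (P := cograph F) s.toInst (a := (cogInl F).obj c) u ((cogInl F).mapPath p) ↔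
      (Paths.lift I.toPrefunctor).map p u = w := by
  induction p with
  | nil => exact eq_comm
  | cons p g ih =>
    constructor
    · rintro ⟨v, hv, h⟩
      have e := (ih v).1 hv
      subst e
      exact h
    · intro h
      exact ⟨_, (ih _).2 rfl, h⟩

/-- The coincidences added by `β_D`, `β_F` and `δ`. -/
def KanState.Coincide (s : KanState F I) (d : D.Ob) (v w : s.J d) : Prop :=
  s.RelD d v w ∨ s.RelF d v w ∨ s.RelFun d v w

/-- The equivalence relation on the instance of a state that is generated by the coincidences. -/
def KanState.cogCoincide (s : KanState F I) :
    ∀ a : CogOb F, cogCarrier F I s.J a → cogCarrier F I s.J a → Prop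
  | .inl _ => fun x y => x = y
  | .inr d => Relation.EqvGen (s.Coincide d)

/-- Over `C` nothing is forced, because `I` consists of functions and satisfies the equations. Over
`D`, the equations of `D` give `β_D`, the naturality squares give `β_F`, functionality of generators
gives `δ`, and the `α_c` are already functional as graphs of `η`. -/
theorem KanState.cogCoincide_of_forced (s : KanState F I) (a : (cograph F).Ob)
    (x y : s.toInst.carrier a) (h : Inst.Forced (P := cograph F) s.toInst a x y) :
    s.cogCoincide a x y := by
  cases h with
  | @eqn a b p q h u _ _ hv hv' =>
    cases h with
    | @ofC c c' p q h =>
      have e₁ := (s.toInst_eval_inl u p x).1 hv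
      have e₂ := (s.toInst_eval_inl u q y).1 hv'
      rw [I.sat p q h] at e₁
      exact e₁.symm.trans e₂
    | @ofD d d' p q h =>
      exact .rel _ _ (Or.inl ⟨p, q, h, u, _, _, (s.toInst_eval_inr u p x).1 hv,
        (s.toInst_eval_inr u q y).1 hv'⟩)
    | @cross c c' f =>
      obtain ⟨w, hw, hv⟩ := (Inst.eval_comp (P := cograph F) _ _ _ _ _).1 hv
      obtain ⟨w', hw', hv'⟩ := (Inst.eval_comp (P := cograph F) _ _ _ _ _).1 hv'
      have hv := (s.toInst_eval_inr w (F.map f) x).1 hv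
      have e : s.η c u = w := (Inst.eval_toPath (P := cograph F) _ _ _ _).1 hw
      have e' : I.app f u = w' := (Inst.eval_toPath (P := cograph F) _ _ _ _).1 hw'
      have e'' : s.η c' w' = y := (Inst.eval_toPath (P := cograph F) _ _ _ _).1 hv'
      subst e e' e''
      -- `β_F` lists the two ends of the square in the opposite order.
      exact .symm _ _ (.rel _ _ (Or.inr (Or.inl ⟨f, u, _, hv⟩)))
  | @functional a _ f u _ _ hv hv' =>
    change CogHom F _ _ at f
    cases f with
    | ofC f => exact Eq.trans (Eq.symm hv) hv'
    | ofD g =>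
      by_cases hne : x = y
      · rw [hne]
        exact .refl _
      · exact .rel _ _ (Or.inr (Or.inr ⟨g, u, _, _, hv, hv', hne⟩))
    | cross c =>
      have e : x = y := Eq.trans (Eq.symm hv) hv'
      rw [e]
      exact .refl _

theorem KanState.forced_of_coincide (s : KanState F I) (d : D.Ob) (v w : s.J d)
    (h : s.Coincide d v w) :
    Inst.Forced (P := cograph F) s.toInst ((cogInr F).obj d) v w ∨
      Inst.Forced (P := cograph F) s.toInst ((cogInr F).obj d) w v := by
  rcases h with ⟨p, q, h, u, _, _, hv, hv'⟩ | ⟨f, u, _, hv⟩ | ⟨g, u, _, _, hv, hv', -⟩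
  · exact Or.inl (.eqn (P := cograph F) _ _ (CogEqn.ofD p q h) u _ _
      ((s.toInst_eval_inr _ _ _).2 hv) ((s.toInst_eval_inr _ _ _).2 hv'))
  · refine Or.inr (.eqn (P := cograph F) _ _ (CogEqn.cross f) u _ _ ?_ ?_)
    · refine (Inst.eval_comp (P := cograph F) _ _ _ _ _).2
        ⟨s.η _ u, (Inst.eval_toPath (P := cograph F) _ _ _ _).2 ?_, (s.toInst_eval_inr _ _ _).2 hv⟩
      exact (rfl : s.η _ u = s.η _ u)
    · refine (Inst.eval_comp (P := cograph F) _ _ _ _ _).2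
        ⟨I.app f u, (Inst.eval_toPath (P := cograph F) _ _ _ _).2 ?_,
          (Inst.eval_toPath (P := cograph F) _ _ _ _).2 ?_⟩
      · exact (rfl : I.app f u = I.app f u)
      · exact (rfl : s.η _ (I.app f u) = s.η _ (I.app f u))
  · refine Or.inl (Inst.Forced.functional (P := cograph F) (X := s.toInst)
      ((cogInr F).map g) ?_ _ _ ?_ ?_)
    · exact u
    · exact hv
    · exact hv'

theorem KanState.eqvGen_forced (s : KanState F I) (d : D.Ob) (v w : s.J d)
    (h : Relation.EqvGen (s.Coincide d) v w) :
    Relation.EqvGen (Inst.Forced (P := cograph F) s.toInst ((cogInr F).obj d)) v w := by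
  induction h with
  | rel x y h =>
    rcases s.forced_of_coincide d x y h with h | h
    · exact .rel _ _ h
    · exact .symm _ _ (.rel _ _ h)
  | refl x => exact .refl _
  | symm x y _ ih => exact .symm _ _ ih
  | trans x y z _ _ ih₁ ih₂ => exact .trans _ _ _ ih₁ ih₂

theorem KanState.activeEgds_nonempty_iff (s : KanState F I) :
    (activeEgds (cogTheory F) s.toInst).Nonempty ↔
      ∃ d v w, s.Coincide d v w ∧ v ≠ w := by
  refine (FastKan.activeEgds_nonempty_iff (P := cograph F)).trans ⟨?_, ?_⟩
  · rintro ⟨a, x, y, h, hne⟩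
    by_contra! hno
    have h' := s.cogCoincide_of_forced a x y h
    rcases a with c | d
    · exact hne h'
    · have aux : ∀ v w, Relation.EqvGen (s.Coincide d) v w → v = w := by
        intro v w h
        induction h with
        | rel x y h => exact hno d x y h
        | refl x => rfl
        | symm x y _ ih => exact ih.symm
        | trans x y z _ _ ih₁ ih₂ => exact ih₁.trans ih₂
      exact hne (aux _ _ h')
  · rintro ⟨d, v, w, h, hne⟩
    rcases s.forced_of_coincide d v w h with h | h
    · exact ⟨_, _, _, h, hne⟩
    · exact ⟨_, _, _, h, hne.symm⟩

/-- Generators of `C` and the `α_c` are total in every state, so only generators of `D` can lack a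
value. -/
theorem KanState.activeTgds_nonempty_iff (s : KanState F I) :
    (activeTgds (cogTheory F) s.toInst).Nonempty ↔
      ∃ (d d' : D.Ob) (g : d ⟶ d') (u : s.J d), ¬ ∃ v, s.edge g u v := by
  refine (FastKan.activeTgds_nonempty_iff (P := cograph F)).trans ⟨?_, ?_⟩
  · rintro ⟨a, b, f, u, h⟩
    change CogHom F _ _ at f
    cases f with
    | ofC f => exact absurd ⟨I.app f u, rfl⟩ h
    | ofD g => exact ⟨_, _, g, u, h⟩
    | cross c => exact absurd ⟨s.η c u, rfl⟩ h
  · rintro ⟨d, d', g, u, h⟩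
    exact ⟨_, _, CogHom.ofD g, u, h⟩

/-- The functions on the sorts of the cograph that are the identity over `C`. -/
def cogMap {J J' : D.Ob → Type u} (h : ∀ d, J d → J' d) :
    ∀ a : CogOb F, cogCarrier F I J a → cogCarrier F I J' a
  | .inl _ => fun x => x
  | .inr d => h d

/-- A map of states: functions that preserve the relations and commute with `η`. -/
structure KanState.Hom (s t : KanState F I) where
  toFun : ∀ d, s.J d → t.J d
  edge : ∀ {d d' : D.Ob} (g : d ⟶ d') {u v}, s.edge g u v → t.edge g (toFun d u) (toFun d' v)
  η : ∀ c x, toFun _ (s.η c x) = t.η c x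

/-- The morphism of instances given by a map of states. -/
def KanState.Hom.toInst {s t : KanState F I} (h : s.Hom t) : s.toInst ⟶ t.toInst :=
  Inst.homMk (P := cograph F) (cogMap h.toFun) (by
    intro a b f x y hxy
    change CogHom F _ _ at f
    cases f with
    | ofC f => exact hxy
    | ofD g => exact h.edge g hxy
    | cross c =>
      have e : s.η c x = y := hxy
      exact (h.η c x).symm.trans (congrArg (h.toFun _) e))

theorem KanState.fromInput_comp {s t : KanState F I} (h : s.Hom t) :
    s.fromInput ≫ h.toInst = t.fromInput :=
  Inst.hom_ext fun a x => by
    rcases a with c | d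
    · rfl
    · exact x.elim

/-- The inclusion of a state into the result of `α`. -/
def KanState.toAlpha (s : KanState F I) : s.Hom s.resetSim.alpha where
  toFun _ := Sum.inl
  edge g _ _ h := .old g _ _ h
  η _ _ := rfl

/-- Resetting `∼` followed by `α` is the parallel chase step with all active tgd triggers. -/
theorem KanState.isParallelStep_alpha (s : KanState F I) :
    IsParallelStep (activeTgds (cogTheory F) s.toInst) s.toAlpha.toInst := by
  -- Only generators of `D` can be undefined; the other two cases are contradictory.
  let new : ∀ b : (cograph F).Ob, Inst.Missing (P := cograph F) s.toInst b →
      s.resetSim.alpha.toInst.carrier b := fun b m =>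
    match b, m with
    | _, ⟨_, .ofC f, u, h⟩ => absurd ⟨I.app f u, rfl⟩ h
    | _, ⟨_, .ofD g, u, h⟩ => Sum.inr ⟨_, g, u, h⟩
    | _, ⟨_, .cross c, u, h⟩ => absurd ⟨s.η c u, rfl⟩ h
  refine FastKan.isParallelStep_activeTgds (P := cograph F) _ new ?_ ?_ ?_
  · rintro b ⟨a, f, u, h⟩
    change CogHom F _ _ at f
    cases f with
    | ofC f => exact absurd ⟨I.app f u, rfl⟩ h
    | ofD g => exact KanState.AlphaEdge.new (s := s.resetSim) g u h
    | cross c => exact absurd ⟨s.η c u, rfl⟩ h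
  · rintro (c | d)
    · refine Function.bijective_iff_has_inverse.2 ⟨Sum.inl, ?_, fun x => rfl⟩
      rintro (x | ⟨a, f, u, h⟩)
      · rfl
      · change CogHom F _ _ at f
        cases f with
        | ofC f => exact absurd ⟨I.app f u, rfl⟩ h
    · refine Function.bijective_iff_has_inverse.2
        ⟨Sum.elim Sum.inl fun m => Sum.inr ⟨.inr m.src, .ofD m.g, m.u, m.missing⟩, ?_, ?_⟩
      · rintro (x | ⟨a, f, u, h⟩)
        · rfl
        · change CogHom F _ _ at f
          cases f with
          | ofD g => rfl
          | cross c => exact absurd ⟨s.η c u, rfl⟩ h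
      · rintro (x | m)
        · rfl
        · rfl
  · intro a b f x y hxy
    change CogHom F _ _ at f
    cases f with
    | ofC f => exact Or.inl ⟨x, y, hxy, rfl, rfl⟩
    | ofD g =>
      cases hxy with
      | old u v h => exact Or.inl ⟨u, v, h, rfl, rfl⟩
      | new u h => exact Or.inr ⟨u, h, rfl, rfl⟩
    | cross c => exact Or.inl ⟨x, s.η c x, rfl, rfl, hxy⟩

/-- The first loop is the parallel chase step with all active tgd triggers on the input. -/
theorem KanState.isParallelStep_initial (F : PresMor C D) (I : Algebra C) :
    IsParallelStep (activeTgds (cogTheory F) (inputInst F I))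
      (KanState.initial F I).fromInput := by
  -- In the input the generators of `C` are total and those of `D` have no source elements. The
  -- missing values are exactly those of the `α_c`, and the one at `u` becomes the pair `(c, u)`.
  let new : ∀ b : (cograph F).Ob, Inst.Missing (P := cograph F) (inputInst F I) b →
      (KanState.initial F I).toInst.carrier b := fun b m =>
    match b, m with
    | _, ⟨_, .ofC f, u, h⟩ => absurd ⟨I.app f u, rfl⟩ h
    | _, ⟨_, .ofD g, u, h⟩ => PEmpty.elim u
    | _, ⟨_, .cross c, u, h⟩ => ⟨⟨c, rfl⟩, u⟩
  refine FastKan.isParallelStep_activeTgds (P := cograph F) _ new ?_ ?_ ?_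
  · rintro b ⟨a, f, u, h⟩
    change CogHom F _ _ at f
    cases f with
    | ofC f => exact absurd ⟨I.app f u, rfl⟩ h
    | ofD g => exact PEmpty.elim u
    | cross c => exact (rfl : (KanState.initial F I).η c u = _)
  · rintro (c | d)
    · refine Function.bijective_iff_has_inverse.2 ⟨Sum.inl, ?_, fun x => rfl⟩
      rintro (x | ⟨a, f, u, h⟩)
      · rfl
      · change CogHom F _ _ at f
        cases f with
        | ofC f => exact absurd ⟨I.app f u, rfl⟩ h
    · let inv : (Σ c : {c : C.Ob // F.obj c = d}, I.obj c.1) →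
          Inst.Missing (P := cograph F) (inputInst F I) (.inr d) := fun y =>
        match d, y with
        | _, ⟨⟨c, rfl⟩, x⟩ => ⟨.inl c, .cross c, x, fun h => h.elim fun _ h => h⟩
      refine Function.bijective_iff_has_inverse.2 ⟨fun y => Sum.inr (inv y), ?_, ?_⟩
      · rintro (x | ⟨a, f, u, h⟩)
        · exact PEmpty.elim x
        · change CogHom F _ _ at f
          cases f with
          | ofD g => exact PEmpty.elim u
          | cross c => rfl
      · rintro ⟨⟨c, rfl⟩, x⟩
        rfl
  · intro a b f x y hxy
    change CogHom F _ _ at f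
    cases f with
    | ofC f => exact Or.inl ⟨x, y, hxy, rfl, rfl⟩
    | ofD g => exact False.elim hxy
    | cross c => exact Or.inr ⟨x, fun h => h.elim fun _ h => h, rfl, hxy⟩

/-- Paths are evaluated in `J` without regard to `∼`. Hence `β_F` and `δ` find the same pairs after
the earlier actions as before them, and the three closures can be merged into one. -/
theorem KanState.addSim_eval (s : KanState F I) (R : ∀ d, s.J d → s.J d → Prop) {d d' : D.Ob}
    (u : s.J d) (p : Quiver.Path d d') : (s.addSim R).eval (d := d) u p = s.eval u p := by
  induction p with
  | nil => rfl
  | cons p g ih =>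
    exact congrArg (fun A : Set (s.J _) => {w | ∃ v ∈ A, s.edge g v w}) ih

theorem KanState.betaD_relF (s : KanState F I) {d : D.Ob} {v w : s.J d} :
    s.betaD.RelF d v w ↔ s.RelF d v w := by
  constructor
  · rintro ⟨f, u, _, h⟩
    exact KanState.RelF.mk (s := s) f u _ ((s.addSim_eval s.RelD _ _) ▸ h)
  · rintro ⟨f, u, _, h⟩
    exact KanState.RelF.mk (s := s.betaD) f u _ ((s.addSim_eval s.RelD _ _).symm ▸ h)

theorem KanState.betaF_relFun (s : KanState F I) {d : D.Ob} {v w : s.J d} :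
    s.betaD.betaF.RelFun d v w ↔ s.RelFun d v w := by
  constructor
  · rintro ⟨f, u, _, _, h, h', hn⟩
    exact KanState.RelFun.mk (s := s) f u _ _ h h' hn
  · rintro ⟨f, u, _, _, h, h', hn⟩
    exact KanState.RelFun.mk (s := s.betaD.betaF) f u _ _ h h' hn

theorem KanState.delta_sim_iff (s : KanState F I) (hs : ∀ d, s.sim d = ⊥) (d : D.Ob)
    (v w : s.J d) :
    (s.betaD.betaF.delta.sim d) v w ↔ Relation.EqvGen (s.Coincide d) v w := by
  -- Minimality of the generated equivalence relation, used once for each nested closure.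
  have gen : ∀ {α : Type u} {r : α → α → Prop} {e : Setoid α} (_ : ∀ x y, r x y → e x y) (x y),
      Relation.EqvGen r x y → e x y := by
    intro α r e h x y hxy
    induction hxy with
    | rel x y hr => exact h x y hr
    | refl x => exact e.refl x
    | symm x y _ ih => exact e.symm ih
    | trans x y z _ _ ih₁ ih₂ => exact e.trans ih₁ ih₂
  constructor
  · refine gen (e := Relation.EqvGen.setoid (s.Coincide d)) ?_ v w
    rintro x y (h | h)
    · refine gen (e := Relation.EqvGen.setoid (s.Coincide d)) ?_ x y h
      rintro x y (h | h)
      · refine gen (e := Relation.EqvGen.setoid (s.Coincide d)) ?_ x y h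
        rintro x y (h | h)
        · rw [hs] at h
          cases h
          exact .refl _
        · exact .rel _ _ (Or.inl h)
      · exact .rel _ _ (Or.inr (Or.inl (s.betaD_relF.1 h)))
    · exact .rel _ _ (Or.inr (Or.inr (s.betaF_relFun.1 h)))
  · refine gen ?_ v w
    rintro x y (h | h | h)
    · exact .rel _ _ (Or.inl (.rel _ _ (Or.inl (.rel _ _ (Or.inr h)))))
    · exact .rel _ _ (Or.inl (.rel _ _ (Or.inr (s.betaD_relF.2 h))))
    · exact .rel _ _ (Or.inr (s.betaF_relFun.2 h))

/-- The projection of a state onto the result of `β_D`, `β_F`, `δ` and `γ`. -/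
def KanState.toGamma (s : KanState F I) : s.Hom s.betaD.betaF.delta.gamma where
  toFun d v := Quotient.mk (s.betaD.betaF.delta.sim d) v
  edge _ u v h := ⟨u, v, h, rfl, rfl⟩
  η _ _ := rfl

/-- `β_D`, `β_F`, `δ` and `γ` together are the parallel chase step with all active egd triggers. -/
theorem KanState.isParallelStep_gamma (s : KanState F I) (hs : ∀ d, s.sim d = ⊥) :
    IsParallelStep (activeEgds (cogTheory F) s.toInst) s.toGamma.toInst := by
  refine FastKan.isParallelStep_activeEgds (P := cograph F) _ ?_ ?_ ?_ ?_
  · rintro (c | d) x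
    · exact ⟨x, rfl⟩
    · obtain ⟨v, rfl⟩ := Quotient.exists_rep x
      exact ⟨v, rfl⟩
  · intro a b f x y hxy
    change CogHom F _ _ at f
    cases f with
    | ofC f => exact ⟨x, y, hxy, rfl, rfl⟩
    | ofD g =>
      obtain ⟨u, v, h, rfl, rfl⟩ := hxy
      exact ⟨u, v, h, rfl, rfl⟩
    | cross c => exact ⟨x, s.η c x, rfl, rfl, hxy⟩
  · intro a x y h
    have h' := s.cogCoincide_of_forced a x y h
    rcases a with c | d
    · exact h'
    · exact Quotient.sound ((s.delta_sim_iff hs d x y).2 h')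
  · intro a x y h
    rcases a with c | d
    · have e : x = y := h
      rw [e]
      exact .refl _
    · exact s.eqvGen_forced d x y ((s.delta_sim_iff hs d x y).1 (Quotient.exact h))

theorem KanState.alpha_sim (s : KanState F I) (d : D.Ob) : s.resetSim.alpha.sim d = ⊥ := by
  refine le_bot_iff.1 fun x y h => ?_
  induction h with
  | rel x y h =>
    obtain ⟨v, w, hvw, rfl, rfl⟩ := h
    exact congrArg Sum.inl hvw
  | refl x => rfl
  | symm x y _ ih => exact Eq.symm ih
  | trans x y z _ _ ih₁ ih₂ => exact Eq.trans ih₁ ih₂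

/-- In the inner loop `∼` is the identity at the start of each pass. -/
def SimTrivial (x : Loc × KanState F I) : Prop := x.1 = .inner → ∀ d, x.2.sim d = ⊥

theorem kanStep_outer_of_guard {first : Bool} {s : KanState F I}
    (h : (activeTgds (cogTheory F) s.toInst).Nonempty ∨ first = true) :
    kanStep (.outer first, s) = (.inner, s.resetSim.alpha) := if_pos h

theorem kanStep_outer_of_not_guard {first : Bool} {s : KanState F I}
    (h : ¬ ((activeTgds (cogTheory F) s.toInst).Nonempty ∨ first = true)) :
    kanStep (.outer first, s) = (.done, s) := if_neg h

theorem kanStep_inner_of_guard {s : KanState F I}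
    (h : (activeEgds (cogTheory F) s.toInst).Nonempty) :
    kanStep (.inner, s) = (.inner, s.betaD.betaF.delta.gamma) := if_pos h

theorem kanStep_inner_of_not_guard {s : KanState F I}
    (h : ¬ (activeEgds (cogTheory F) s.toInst).Nonempty) :
    kanStep (.inner, s) = (.outer false, s) := if_neg h

/-- The inner loop is entered after a reset followed by `α`, and each of its passes ends with `γ`;
both leave `∼` trivial. -/
theorem simTrivial_kanStep (x : Loc × KanState F I) : SimTrivial (kanStep x) := by
  obtain ⟨first | _ | _, s⟩ := x
  · by_cases h : (activeTgds (cogTheory F) s.toInst).Nonempty ∨ first = true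
    · rw [kanStep_outer_of_guard h]
      exact fun _ => s.alpha_sim
    · rw [kanStep_outer_of_not_guard h]
      exact fun h => nomatch h
  · by_cases h : (activeEgds (cogTheory F) s.toInst).Nonempty
    · rw [kanStep_inner_of_guard h]
      exact fun _ _ => rfl
    · rw [kanStep_inner_of_not_guard h]
      exact fun h => nomatch h
  · exact fun h => nomatch h

/-- Each transition of the fast left Kan algorithm is a transition of the fast parallel chase. -/
theorem chaseStep_kanStep (x : Loc × KanState F I) (hx : SimTrivial x) (hd : x.1 ≠ .done) :
    ChaseStep (cogTheory F) (toChase x) (toChase (kanStep x)) := by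
  obtain ⟨first | _ | _, s⟩ := x
  · by_cases hg : (activeTgds (cogTheory F) s.toInst).Nonempty ∨ first = true
    · have := ChaseStep.tgds first s.fromInput s.toAlpha.toInst hg s.isParallelStep_alpha
      rw [KanState.fromInput_comp] at this
      rw [kanStep_outer_of_guard hg]
      exact this
    · rw [kanStep_outer_of_not_guard hg]
      rw [not_or] at hg
      obtain rfl : first = false := by simpa using hg.2
      exact ChaseStep.exitOuter (T := cogTheory F) s.fromInput hg.1
  · by_cases hg : (activeEgds (cogTheory F) s.toInst).Nonempty
    · have := ChaseStep.egds s.fromInput s.toGamma.toInst hg (s.isParallelStep_gamma (hx rfl))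
      rw [KanState.fromInput_comp] at this
      rw [kanStep_inner_of_guard hg]
      exact this
    · rw [kanStep_inner_of_not_guard hg]
      exact ChaseStep.exitInner (T := cogTheory F) s.fromInput hg
  · exact absurd rfl hd

end States

/-! ### Models, reachability and weak initiality -/

section Models

variable {C D : CatPres.{u}} {F : PresMor C D} {I : Algebra C}

/-- All edges of the state are total relations. -/
def KanState.Total (s : KanState F I) : Prop :=
  ∀ ⦃d d' : D.Ob⦄ (g : d ⟶ d') (u : s.J d), ∃ v, s.edge g u v

/-- The state has no nontrivial coincidences. -/
def KanState.Saturated (s : KanState F I) : Prop :=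
  ∀ (d : D.Ob) (v w : s.J d), s.Coincide d v w → v = w

/-- Every element is the value of a path at an element of the image of `η`. -/
def KanState.Reachable (s : KanState F I) : Prop :=
  ∀ (d : D.Ob) (v : s.J d), ∃ (c : C.Ob) (x : I.obj c) (p : Quiver.Path (F.obj c) d),
    v ∈ s.eval (s.η c x) p

/-- A state with a map to every total and saturated state. -/
def KanState.WeaklyInitial (s : KanState F I) : Prop :=
  ∀ t : KanState F I, t.Total → t.Saturated → Nonempty (s.Hom t)

theorem KanState.saturated_iff (s : KanState F I) :
    s.Saturated ↔ ¬ (activeEgds (cogTheory F) s.toInst).Nonempty := by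
  rw [s.activeEgds_nonempty_iff]
  push Not
  rfl

theorem KanState.total_iff (s : KanState F I) :
    s.Total ↔ ¬ (activeTgds (cogTheory F) s.toInst).Nonempty := by
  rw [s.activeTgds_nonempty_iff]
  push Not
  rfl

theorem KanState.Saturated.edge_unique {s : KanState F I} (h : s.Saturated) {d d' : D.Ob}
    {g : d ⟶ d'} {u : s.J d} {v w : s.J d'} (hv : s.edge g u v) (hw : s.edge g u w) : v = w := by
  by_contra hne
  exact hne (h _ _ _ (Or.inr (Or.inr ⟨g, u, v, w, hv, hw, hne⟩)))

theorem KanState.Saturated.eval_unique {s : KanState F I} (h : s.Saturated) {d d' : D.Ob}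
    {u : s.J d} {p : Quiver.Path d d'} {v w : s.J d'} (hv : v ∈ s.eval u p)
    (hw : w ∈ s.eval u p) : v = w := by
  induction p with
  | nil => exact Eq.trans hv (Eq.symm hw)
  | cons p g ih =>
    obtain ⟨v', hv', ev⟩ := hv
    obtain ⟨w', hw', ew⟩ := hw
    obtain rfl := ih hv' hw'
    exact h.edge_unique ev ew

theorem KanState.Total.exists_eval {s : KanState F I} (h : s.Total) {d d' : D.Ob}
    (u : s.J d) (p : Quiver.Path d d') : ∃ v, v ∈ s.eval u p := by
  induction p with
  | nil => exact ⟨u, rfl⟩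
  | cons p g ih =>
    obtain ⟨v, hv⟩ := ih
    obtain ⟨w, hw⟩ := h g v
    exact ⟨w, v, hv, hw⟩

theorem KanState.Hom.mem_eval {s t : KanState F I} (h : s.Hom t) {d d' : D.Ob} {u : s.J d}
    {p : Quiver.Path d d'} {v : s.J d'} (hv : v ∈ s.eval u p) :
    h.toFun d' v ∈ t.eval (h.toFun d u) p := by
  induction p with
  | nil => exact congrArg (h.toFun d) hv
  | cons p g ih =>
    obtain ⟨w, hw, e⟩ := hv
    exact ⟨_, ih hw, h.edge g e⟩

/-- Maps of states preserve values of paths and `η`, hence coincidences, and these are equalities in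
a saturated target. -/
theorem KanState.Hom.coincide {s t : KanState F I} (h : s.Hom t) (ht : t.Saturated) {d : D.Ob}
    {v w : s.J d} (hvw : s.Coincide d v w) : h.toFun d v = h.toFun d w := by
  rcases hvw with ⟨p, q, e, u, _, _, hv, hv'⟩ | ⟨f, u, _, hv⟩ | ⟨g, u, _, _, hv, hv', -⟩
  · exact ht _ _ _ (Or.inl ⟨p, q, e, _, _, _, h.mem_eval hv, h.mem_eval hv'⟩)
  · rw [h.η]
    refine ht _ _ _ (Or.inr (Or.inl ⟨f, u, _, ?_⟩))
    rw [← h.η]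
    exact h.mem_eval hv
  · exact ht.edge_unique (h.edge g hv) (h.edge g hv')

/-- The identity map of a state. -/
def KanState.Hom.id (s : KanState F I) : s.Hom s := ⟨fun _ x => x, fun _ _ _ h => h, fun _ _ => rfl⟩

/-- The composite of two maps of states. -/
def KanState.Hom.comp {s t r : KanState F I} (h : s.Hom t) (k : t.Hom r) : s.Hom r where
  toFun d x := k.toFun d (h.toFun d x)
  edge g _ _ e := k.edge g (h.edge g e)
  η c x := by rw [h.η, k.η]

/-- Two maps agree on `η`; every element is the value of a path there, and paths have at most one
value in a saturated state. -/
theorem KanState.Hom.unique {s t : KanState F I} (hs : s.Reachable) (ht : t.Saturated)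
    (h k : s.Hom t) : h = k := by
  have e : h.toFun = k.toFun := by
    funext d v
    obtain ⟨c, x, p, hv⟩ := hs d v
    have h₁ := h.mem_eval hv
    have h₂ := k.mem_eval hv
    rw [h.η] at h₁
    rw [k.η] at h₂
    exact ht.eval_unique h₁ h₂
  cases h
  cases k
  cases e
  rfl

/-- An element of the target is named by a path at some `η(x)`. Totality of the source gives this
path a value there, and saturation of the target makes its image the given element. -/
theorem KanState.Hom.surjective {s t : KanState F I} (h : s.Hom t) (hs : s.Total)
    (ht : t.Saturated) (ht' : t.Reachable) (d : D.Ob) : Function.Surjective (h.toFun d) := by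
  intro v
  obtain ⟨c, x, p, hv⟩ := ht' d v
  obtain ⟨w, hw⟩ := hs.exists_eval (s.η c x) p
  have := h.mem_eval hw
  rw [h.η] at this
  exact ⟨w, ht.eval_unique this hv⟩

/-- Two models that are reachable and weakly initial are isomorphic under the input. -/
theorem KanState.exists_iso {s t : KanState F I} (hs : s.Total) (hs' : s.Saturated)
    (hsr : s.Reachable) (hsi : s.WeaklyInitial) (ht : t.Total) (ht' : t.Saturated)
    (htr : t.Reachable) (hti : t.WeaklyInitial) :
    ∃ e : s.toInst ≅ t.toInst, s.fromInput ≫ e.hom = t.fromInput := by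
  obtain ⟨h⟩ := hsi t ht ht'
  obtain ⟨k⟩ := hti s hs hs'
  have e₁ : h.comp k = KanState.Hom.id s := KanState.Hom.unique hsr hs' _ _
  have e₂ : k.comp h = KanState.Hom.id t := KanState.Hom.unique htr ht' _ _
  have f₁ : (h.comp k).toInst = 𝟙 s.toInst := by
    rw [e₁]
    exact Inst.hom_ext fun a x => by rcases a with c | d <;> rfl
  have f₂ : (k.comp h).toInst = 𝟙 t.toInst := by
    rw [e₂]
    exact Inst.hom_ext fun a x => by rcases a with c | d <;> rfl
  refine ⟨⟨h.toInst, k.toInst, ?_, ?_⟩, KanState.fromInput_comp h⟩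
  · rw [← f₁]
    exact Inst.hom_ext fun a x => by rcases a with c | d <;> rfl
  · rw [← f₂]
    exact Inst.hom_ext fun a x => by rcases a with c | d <;> rfl

/-! ### Preservation by the transitions -/

theorem KanState.reachable_initial : (KanState.initial F I).Reachable := by
  rintro d ⟨⟨c, rfl⟩, x⟩
  exact ⟨c, x, .nil, rfl⟩

/-- S₀ is free on `I` and has no edges, so the `η` of the target already is a map. -/
theorem KanState.weaklyInitial_initial : (KanState.initial F I).WeaklyInitial := by
  intro t _ _
  let h : ∀ d, (KanState.initial F I).J d → t.J d := fun d y =>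
    match d, y with
    | _, ⟨⟨c, rfl⟩, x⟩ => t.η c x
  exact ⟨⟨h, fun _ _ _ e => e.elim, fun _ _ => rfl⟩⟩

theorem KanState.Reachable.alpha {s : KanState F I} (hs : s.Reachable) :
    s.resetSim.alpha.Reachable := by
  rintro d (v | ⟨d', g, u, h⟩)
  · obtain ⟨c, x, p, hv⟩ := hs d v
    exact ⟨c, x, p, s.toAlpha.mem_eval hv⟩
  · obtain ⟨c, x, p, hu⟩ := hs d' u
    exact ⟨c, x, p.cons g, Sum.inl u, s.toAlpha.mem_eval hu,
      KanState.AlphaEdge.new (s := s.resetSim) g u h⟩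

/-- A fresh `g(u)` is sent to a chosen value of `g` at the image of `u`; the target is total. -/
theorem KanState.WeaklyInitial.alpha {s : KanState F I} (hs : s.WeaklyInitial) :
    s.resetSim.alpha.WeaklyInitial := by
  intro t ht ht'
  obtain ⟨h⟩ := hs t ht ht'
  choose act hact using ht
  refine ⟨⟨fun d => Sum.elim (h.toFun d) fun m => act m.g (h.toFun m.src m.u), ?_, h.η⟩⟩
  intro d d' g u v e
  cases e with
  | old u v e => exact h.edge g e
  | new u e => exact hact g _

theorem KanState.Reachable.gamma {s : KanState F I} (hs : s.Reachable) :
    s.betaD.betaF.delta.gamma.Reachable := by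
  intro d v
  obtain ⟨v, rfl⟩ := Quotient.exists_rep v
  obtain ⟨c, x, p, hv⟩ := hs d v
  exact ⟨c, x, p, s.toGamma.mem_eval hv⟩

/-- A map to a saturated state identifies all coincidences and so descends to the quotient.
Triviality of `∼` ensures that nothing else is identified. -/
theorem KanState.WeaklyInitial.gamma {s : KanState F I} (hsim : ∀ d, s.sim d = ⊥)
    (hs : s.WeaklyInitial) : s.betaD.betaF.delta.gamma.WeaklyInitial := by
  intro t ht ht'
  obtain ⟨h⟩ := hs t ht ht'
  have key : ∀ d v w, Relation.EqvGen (s.Coincide d) v w → h.toFun d v = h.toFun d w := by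
    intro d v w hvw
    induction hvw with
    | rel x y e => exact h.coincide ht' e
    | refl x => rfl
    | symm x y _ ih => exact ih.symm
    | trans x y z _ _ ih₁ ih₂ => exact ih₁.trans ih₂
  refine ⟨⟨fun d => Quotient.lift (h.toFun d) fun v w hvw =>
    key d v w ((s.delta_sim_iff hsim d v w).1 hvw), ?_, h.η⟩⟩
  rintro d d' g _ _ ⟨u, v, e, rfl, rfl⟩
  exact h.edge g e

theorem KanState.finite_initial (hC : C.IsFinite) (hI : ∀ c, Finite (I.obj c)) (d : D.Ob) :
    Finite ((KanState.initial F I).J d) := by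
  have := hC.ob
  have := hI
  exact inferInstanceAs (Finite (Σ c : {c : C.Ob // F.obj c = d}, I.obj c.1))

theorem KanState.finite_alpha (hD : D.IsFinite) {s : KanState F I} (hs : ∀ d, Finite (s.J d))
    (d : D.Ob) : Finite (s.resetSim.alpha.J d) := by
  have := hD.ob
  have := hD.hom
  have : Finite (s.resetSim.Fresh d) :=
    Finite.of_injective (β := Σ d' : D.Ob, (d' ⟶ d) × s.J d') (fun m => ⟨m.src, m.g, m.u⟩) (by
      rintro ⟨a, g, u, h⟩ ⟨a', g', u', h'⟩ e
      cases e
      rfl)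
  exact inferInstanceAs (Finite (s.J d ⊕ s.resetSim.Fresh d))

theorem KanState.finite_gamma {s : KanState F I} (hs : ∀ d, Finite (s.J d))
    (d : D.Ob) : Finite (s.betaD.betaF.delta.gamma.J d) :=
  Finite.of_surjective (s.toGamma.toFun d) Quotient.exists_rep

/-- What holds at each configuration of a run. -/
structure Invariant (x : Loc × KanState F I) : Prop where
  sim : SimTrivial x
  reachable : x.2.Reachable
  weaklyInitial : x.2.WeaklyInitial
  finite : ∀ d, Finite (x.2.J d)
  saturated : x.1 = .outer false ∨ x.1 = .done → x.2.Saturated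
  total : x.1 = .done → x.2.Total

/-- Saturation is gained on leaving the inner loop and totality on leaving the outer loop. At
`.outer true` neither is claimed, and from there the run cannot halt directly. -/
theorem Invariant.kanStep (hD : D.IsFinite) {x : Loc × KanState F I} (h : Invariant x) :
    Invariant (kanStep x) := by
  obtain ⟨first | _ | _, s⟩ := x
  · by_cases hg : (activeTgds (cogTheory F) s.toInst).Nonempty ∨ first = true
    · have hsim := simTrivial_kanStep (.outer first, s)
      rw [kanStep_outer_of_guard hg] at hsim ⊢
      exact ⟨hsim, h.reachable.alpha, h.weaklyInitial.alpha, KanState.finite_alpha hD h.finite,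
        by simp, by simp⟩
    · have hsim := simTrivial_kanStep (.outer first, s)
      rw [kanStep_outer_of_not_guard hg] at hsim ⊢
      rw [not_or] at hg
      obtain rfl : first = false := by simpa using hg.2
      exact ⟨hsim, h.reachable, h.weaklyInitial, h.finite, fun _ => h.saturated (Or.inl rfl),
        fun _ => s.total_iff.2 hg.1⟩
  · have hsim := simTrivial_kanStep (.inner, s)
    by_cases hg : (activeEgds (cogTheory F) s.toInst).Nonempty
    · rw [kanStep_inner_of_guard hg] at hsim ⊢
      exact ⟨hsim, h.reachable.gamma, h.weaklyInitial.gamma (h.sim rfl),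
        KanState.finite_gamma h.finite, by simp, by simp⟩
    · rw [kanStep_inner_of_not_guard hg] at hsim ⊢
      exact ⟨hsim, h.reachable, h.weaklyInitial, h.finite, fun _ => s.saturated_iff.2 hg,
        by simp⟩
  · exact h

theorem Invariant.iterate (hD : D.IsFinite) {x : Loc × KanState F I} (h : Invariant x) (n : ℕ) :
    Invariant (FastKan.kanStep^[n] x) := by
  induction n with
  | zero => exact h
  | succ n ih =>
    rw [Function.iterate_succ_apply']
    exact ih.kanStep hD

/-- The two values of `l` are the start of the algorithm and the point that the chase on the input
reaches with its first step. -/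
theorem invariant_initial (hC : C.IsFinite) (hI : ∀ c, Finite (I.obj c)) {l : Loc}
    (hl : l = .outer true ∨ l = .inner) : Invariant (l, KanState.initial F I) :=
  ⟨fun _ _ => rfl, KanState.reachable_initial, KanState.weaklyInitial_initial,
    KanState.finite_initial hC hI, by rcases hl with rfl | rfl <;> simp,
    by rcases hl with rfl | rfl <;> simp⟩

/-! ### Models and functors -/

/-- The action of a generating morphism on a total state. -/
noncomputable def KanState.Total.act {s : KanState F I} (h : s.Total) {d d' : D.Ob} (g : d ⟶ d')
    (u : s.J d) : s.J d' := (h g u).choose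

theorem KanState.Total.edge_act {s : KanState F I} (h : s.Total) {d d' : D.Ob} (g : d ⟶ d')
    (u : s.J d) : s.edge g u (h.act g u) := (h g u).choose_spec

/-- The algebra on the quiver of `D` given by a total state. -/
noncomputable def KanState.Total.prefunctor {s : KanState F I} (h : s.Total) : D.Ob ⥤q Type u where
  obj d := s.J d
  map g := TypeCat.ofHom (h.act g)

theorem KanState.Total.lift_mem_eval {s : KanState F I} (h : s.Total) {d d' : D.Ob}
    (p : Quiver.Path d d') (u : s.J d) : (Paths.lift h.prefunctor).map p u ∈ s.eval u p := by
  induction p with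
  | nil => exact rfl
  | cons p g ih => exact ⟨_, ih, h.edge_act g _⟩

/-- The algebra of `D` given by a model. -/
noncomputable def KanState.toAlgebra (s : KanState F I) (h : s.Total) (h' : s.Saturated) :
    Algebra D where
  toPrefunctor := h.prefunctor
  sat p q e := by
    ext u
    exact h' _ _ _ (Or.inl ⟨p, q, e, u, _, _, h.lift_mem_eval p u, h.lift_mem_eval q u⟩)

/-- The functor given by a model. -/
noncomputable abbrev KanState.toFunctor (s : KanState F I) (h : s.Total) (h' : s.Saturated) :
    D.Cat ⥤ Type u := (s.toAlgebra h h').functor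

theorem KanState.toFunctor_map_mem_eval (s : KanState F I) (h : s.Total) (h' : s.Saturated)
    {d d' : D.Ob} (p : Quiver.Path d d') (u : s.J d) :
    ((s.toFunctor h h').map (D.proj.map p) u : s.J d') ∈ s.eval u p :=
  h.lift_mem_eval p u

theorem KanState.η_lift (s : KanState F I) (h : s.Total) (h' : s.Saturated)
    {c c' : C.Ob} (p : Quiver.Path c c') (x : I.obj c) :
    s.η c' ((Paths.lift I.toPrefunctor).map p x) ∈ s.eval (s.η c x) (F.onPaths.map p) := by
  induction p with
  | nil => exact rfl
  | cons p f ih =>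
    refine (s.eval_comp _ _ _ _).2 ⟨_, ih, ?_⟩
    -- `β_F` pairs `η(f y)` with every value of the path `F(f)` at `η(y)`. Totality supplies such a
    -- value, and saturation identifies it with `η(f y)`.
    obtain ⟨v, hv⟩ := h.exists_eval (s.η _ ((Paths.lift I.toPrefunctor).map p x)) (F.map f)
    have := h' _ _ _ (Or.inr (Or.inl ⟨f, _, v, hv⟩))
    exact this ▸ hv

/-- The unit of the functor given by a model. -/
noncomputable def KanState.unit (s : KanState F I) (h : s.Total) (h' : s.Saturated) :
    I.functor ⟶ F.functor ⋙ s.toFunctor h h' :=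
  CategoryTheory.Quotient.natTransLift _
    { app := fun c => TypeCat.ofHom (s.η c)
      naturality := by
        intro c c' p
        ext x
        exact h'.eval_unique (s.η_lift h h' p x)
          (s.toFunctor_map_mem_eval h h' (F.onPaths.map p) (s.η c x)) }

theorem KanState.represents_toFunctor (s : KanState F I) (h : s.Total) (h' : s.Saturated) :
    s.Represents (s.toFunctor h h') (s.unit h h') := by
  refine ⟨fun d => Equiv.refl _, fun d d' g u v => ?_, fun c x => rfl⟩
  have := s.toFunctor_map_mem_eval h h' ((Paths.of D.Ob).map g) u
  obtain ⟨w, hw, e⟩ := this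
  obtain rfl : w = u := hw
  exact ⟨fun e' => h'.edge_unique e e', fun e' => Eq.subst (motive := fun z => s.edge g w z) e' e⟩

/-- The state given by a functor and a transformation. -/
def KanState.ofFunctor (G : D.Cat ⥤ Type u) (γ : I.functor ⟶ F.functor ⋙ G) : KanState F I where
  J d := G.obj (D.proj.obj d)
  sim _ := ⊥
  edge _ _ g u v := G.map (D.proj.map ((Paths.of D.Ob).map g)) u = v
  η c x := γ.app (C.proj.obj c) (I.elt x)

section OfFunctor

variable (G : D.Cat ⥤ Type u) (γ : I.functor ⟶ F.functor ⋙ G)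

theorem KanState.mem_eval_ofFunctor {d d' : D.Ob} (p : Quiver.Path d d')
    (u : (KanState.ofFunctor G γ).J d) (v : (KanState.ofFunctor G γ).J d') :
    v ∈ (KanState.ofFunctor G γ).eval u p ↔ G.map (D.proj.map p) u = v := by
  induction p with
  | nil =>
    have e : G.map (D.proj.map (Quiver.Path.nil : Quiver.Path d d)) = 𝟙 _ := G.map_id _
    rw [e]
    exact eq_comm
  | @cons d' d'' p g ih =>
    have e : G.map (D.proj.map (p.cons g)) =
        G.map (D.proj.map p) ≫ G.map (D.proj.map ((Paths.of D.Ob).map g)) :=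
      (congrArg G.map (D.proj.map_comp (X := d) (Y := d') (Z := d'') p
        ((Paths.of D.Ob).map g))).trans (G.map_comp _ _)
    rw [e]
    constructor
    · rintro ⟨w, hw, h⟩
      have := (ih w).1 hw
      subst this
      exact h
    · intro h
      exact ⟨_, (ih _).2 rfl, h⟩

theorem KanState.total_ofFunctor : (KanState.ofFunctor G γ).Total := fun _ _ _ _ => ⟨_, rfl⟩

/-- The pairs of `β_D` agree because the functor lives on the presented category, those of `β_F` by
naturality of `γ`, and those of `δ` because the edges are graphs. So weak initiality can be tested
against any functor with a transformation. -/
theorem KanState.saturated_ofFunctor : (KanState.ofFunctor G γ).Saturated := by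
  rintro d v w (⟨p, q, e, u, _, _, hv, hv'⟩ | ⟨f, x, _, hv⟩ | ⟨g, u, _, _, hv, hv', -⟩)
  · rw [KanState.mem_eval_ofFunctor] at hv hv'
    have : D.proj.map p = D.proj.map q := CategoryTheory.Quotient.sound _ e
    rw [← hv, ← hv', this]
  · rw [KanState.mem_eval_ofFunctor] at hv
    rw [← hv]
    have h := ConcreteCategory.congr_hom
      (γ.naturality (C.proj.map ((Paths.of C.Ob).map f))) (I.elt x)
    have e₁ : I.functor.map (C.proj.map ((Paths.of C.Ob).map f)) (I.elt x) =
      I.elt (I.app f x) := by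
      exact ConcreteCategory.congr_hom (Paths.lift_toPath I.toPrefunctor f) x
    have e₂ : F.functor.map (C.proj.map ((Paths.of C.Ob).map f)) = D.proj.map (F.map f) :=
      congrArg D.proj.map (Paths.lift_toPath (C := Paths D.Ob) _ f)
    refine Eq.trans ?_ (h.trans ?_)
    · exact congrArg (γ.app _) e₁.symm
    · exact congrArg (fun k => G.map k (γ.app _ (I.elt x))) e₂
  · exact hv.symm.trans hv'

end OfFunctor

/-- The transformation out of the functor given by a model that corresponds to a map of states. -/
noncomputable def KanState.Hom.toNatTrans {s : KanState F I} (h : s.Total) (h' : s.Saturated)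
    {G : D.Cat ⥤ Type u} {γ : I.functor ⟶ F.functor ⋙ G} (k : s.Hom (KanState.ofFunctor G γ)) :
    s.toFunctor h h' ⟶ G :=
  CategoryTheory.Quotient.natTransLift _
    { app := fun d => TypeCat.ofHom (k.toFun d)
      naturality := by
        intro d d' p
        ext u
        exact ((KanState.mem_eval_ofFunctor G γ p _ _).1
          (k.mem_eval (s.toFunctor_map_mem_eval h h' p u))).symm }

/-- The map of states given by a transformation into the functor given by a model. -/
def KanState.homOfNatTrans {t : KanState F I} (h : t.Total) (h' : t.Saturated)
    {G : D.Cat ⥤ Type u} {γ : I.functor ⟶ F.functor ⋙ G} (θ : G ⟶ t.toFunctor h h')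
    (hθ : γ ≫ Functor.whiskerLeft F.functor θ = t.unit h h') :
    (KanState.ofFunctor G γ).Hom t where
  toFun d := θ.app (D.proj.obj d)
  edge {d d'} g u v e := by
    have e' : G.map (D.proj.map ((Paths.of D.Ob).map g)) u = v := e
    subst e'
    have e := ConcreteCategory.congr_hom (θ.naturality (D.proj.map ((Paths.of D.Ob).map g))) u
    obtain ⟨w, hw, hwe⟩ := t.toFunctor_map_mem_eval h h' ((Paths.of D.Ob).map g)
      (θ.app (D.proj.obj d) u)
    obtain rfl : w = _ := hw
    exact Eq.subst (motive := fun z => t.edge g (θ.app (D.proj.obj d) u) z) e.symm hwe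
  η c x := ConcreteCategory.congr_hom (NatTrans.congr_app hθ (C.proj.obj c)) (I.elt x)

/-- A reachable, weakly initial model is a left Kan extension. -/
theorem KanState.isLeftKanExtension (s : KanState F I) (h : s.Total) (h' : s.Saturated)
    (hr : s.Reachable) (hi : s.WeaklyInitial) :
    (s.toFunctor h h').IsLeftKanExtension (s.unit h h') := by
  refine ⟨⟨Limits.IsInitial.ofUniqueHom (fun Y => ?_) ?_⟩⟩
  · have k := (hi _ (KanState.total_ofFunctor Y.right Y.hom)
      (KanState.saturated_ofFunctor Y.right Y.hom)).some
    refine StructuredArrow.homMk (k.toNatTrans h h') ?_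
    ext ⟨c⟩ x
    exact k.η c x
  · intro Y m
    refine StructuredArrow.ext _ _ ?_
    -- Every transformation compatible with the units comes from a map of states, so uniqueness of
    -- such maps gives uniqueness of the factorization.
    have aux : ∀ θ : s.toFunctor h h' ⟶ Y.right,
        s.unit h h' ≫ Functor.whiskerLeft F.functor θ = Y.hom →
        ∃ k : s.Hom (KanState.ofFunctor Y.right Y.hom), θ = k.toNatTrans h h' := by
      intro θ hθ
      refine ⟨⟨fun d => θ.app (D.proj.obj d), ?_, ?_⟩, ?_⟩
      · intro d d' g u v e
        have e' := ConcreteCategory.congr_hom (θ.naturality (D.proj.map ((Paths.of D.Ob).map g))) u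
        obtain ⟨w, hw, hwe⟩ := s.toFunctor_map_mem_eval h h' ((Paths.of D.Ob).map g) u
        obtain rfl : w = u := hw
        have := h'.edge_unique e hwe
        subst this
        exact e'.symm
      · intro c x
        exact ConcreteCategory.congr_hom (NatTrans.congr_app hθ (C.proj.obj c)) (I.elt x)
      · ext ⟨d⟩ u
        rfl
    obtain ⟨k, hk⟩ := aux m.right (StructuredArrow.w m)
    refine hk.trans ?_
    exact congrArg (fun k : s.Hom (KanState.ofFunctor Y.right Y.hom) => k.toNatTrans h h')
      (KanState.Hom.unique hr (KanState.saturated_ofFunctor _ _) _ _)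

end Models

/-! ### The limit of an infinite run -/

section Limit

variable {C D : CatPres.{u}} {F : PresMor C D} {I : Algebra C}

/-- Formal terms: a path of `D` applied to `η(x)` for an element `x` of `I`. -/
structure KanTerm (F : PresMor C D) (I : Algebra C) (d : D.Ob) : Type u where
  src : C.Ob
  elt : I.obj src
  path : Quiver.Path (F.obj src) d

/-- Apply a generating morphism to a term. -/
def KanTerm.cons {d d' : D.Ob} (t : KanTerm F I d) (g : d ⟶ d') : KanTerm F I d' :=
  ⟨t.src, t.elt, t.path.cons g⟩

/-- Apply a path to a term. -/
def KanTerm.comp {d d' : D.Ob} (t : KanTerm F I d) (p : Quiver.Path d d') : KanTerm F I d' :=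
  ⟨t.src, t.elt, t.path.comp p⟩

/-- The values of a term in a state. -/
def KanState.value (s : KanState F I) {d : D.Ob} (t : KanTerm F I d) : Set (s.J d) :=
  s.eval (s.η t.src t.elt) t.path

theorem KanState.Saturated.value_unique {s : KanState F I} (h : s.Saturated) {d : D.Ob}
    {t : KanTerm F I d} {v w : s.J d} (hv : v ∈ s.value t) (hw : w ∈ s.value t) : v = w :=
  h.eval_unique hv hw

theorem KanState.Hom.mem_value {s r : KanState F I} (h : s.Hom r) {d : D.Ob}
    {t : KanTerm F I d} {v : s.J d} (hv : v ∈ s.value t) : h.toFun d v ∈ r.value t := by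
  have := h.mem_eval hv
  rw [h.η] at this
  exact this

/-- Two terms have a common value in a state. -/
def KanState.Same (s : KanState F I) {d : D.Ob} (t t' : KanTerm F I d) : Prop :=
  ∃ v, v ∈ s.value t ∧ v ∈ s.value t'

theorem KanState.Hom.same {s r : KanState F I} (h : s.Hom r) {d : D.Ob}
    {t t' : KanTerm F I d} (hs : s.Same t t') : r.Same t t' :=
  hs.elim fun v hv => ⟨h.toFun d v, h.mem_value hv.1, h.mem_value hv.2⟩

/-- A sequence of states and maps in which infinitely many states are saturated and each missing
value is eventually added. -/
structure IsFairChain (s : ℕ → KanState F I) : Prop where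
  hom : ∀ {n m : ℕ}, n ≤ m → Nonempty ((s n).Hom (s m))
  saturated : ∀ n, ∃ m, n ≤ m ∧ (s m).Saturated
  total : ∀ (n : ℕ) {d d' : D.Ob} (g : d ⟶ d') (u : (s n).J d),
    ∃ (m : ℕ) (h : (s n).Hom (s m)) (v : (s m).J d'), (s m).edge g (h.toFun d u) v

namespace IsFairChain

variable {s : ℕ → KanState F I} (hs : IsFairChain s)

include hs

/-- Terms are built from `η` and paths, which every map of states respects. For this reason a fair
chain needs only the existence of maps between its stages, not a coherent choice of them. -/
theorem same_mono {n m : ℕ} (hnm : n ≤ m) {d : D.Ob} {t t' : KanTerm F I d}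
    (h : (s n).Same t t') : (s m).Same t t' :=
  (hs.hom hnm).elim fun k => k.same h

theorem same_cons {n : ℕ} {d d' : D.Ob} {t t' : KanTerm F I d}
    (h : (s n).Same t t') (g : d ⟶ d') : ∃ m, (s m).Same (t.cons g) (t'.cons g) := by
  obtain ⟨v, hv, hv'⟩ := h
  obtain ⟨m, k, w, hw⟩ := hs.total n g v
  exact ⟨m, w, ⟨_, k.mem_value hv, hw⟩, ⟨_, k.mem_value hv', hw⟩⟩

theorem same_refl {d : D.Ob} (t : KanTerm F I d) : ∃ n, (s n).Same t t := by
  obtain ⟨c, x, p⟩ := t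
  induction p with
  | nil => exact ⟨0, (s 0).η c x, rfl, rfl⟩
  | cons p g ih =>
    obtain ⟨n, h⟩ := ih
    exact hs.same_cons h g

/-- The values of `t'` found at two stages may differ; at a later saturated stage they coincide. -/
theorem same_trans {n m : ℕ} {d : D.Ob} {t t' t'' : KanTerm F I d}
    (h : (s n).Same t t') (h' : (s m).Same t' t'') : ∃ k, (s k).Same t t'' := by
  obtain ⟨k, hk, hsat⟩ := hs.saturated (max n m)
  obtain ⟨v, hv, hv'⟩ := hs.same_mono (le_trans (le_max_left _ _) hk) h
  obtain ⟨w, hw, hw'⟩ := hs.same_mono (le_trans (le_max_right _ _) hk) h'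
  obtain rfl := hsat.value_unique hv' hw
  exact ⟨k, v, hv, hw'⟩

/-- Terms are identified if they eventually have a common value. -/
def setoid (d : D.Ob) : Setoid (KanTerm F I d) where
  r t t' := ∃ n, (s n).Same t t'
  iseqv :=
    ⟨hs.same_refl, fun ⟨n, v, hv, hv'⟩ => ⟨n, v, hv', hv⟩,
      fun ⟨_, h⟩ ⟨_, h'⟩ => hs.same_trans h h'⟩

/-- The limit of a fair chain: terms modulo eventual equality. -/
def limit : KanState F I where
  J d := _root_.Quotient (hs.setoid d)
  sim _ := ⊥
  edge _ _ g x y := ∃ t, x = Quotient.mk _ t ∧ y = Quotient.mk _ (t.cons g)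
  η c x := Quotient.mk _ ⟨c, x, .nil⟩

theorem edge_limit {d d' : D.Ob} {g : d ⟶ d'} {t : KanTerm F I d} {y : hs.limit.J d'}
    (h : hs.limit.edge g (Quotient.mk _ t) y) : y = Quotient.mk _ (t.cons g) := by
  obtain ⟨t', ht, rfl⟩ := h
  obtain ⟨n, hn⟩ : (hs.setoid d) t t' := Quotient.exact ht
  refine Quotient.sound ?_
  obtain ⟨m, v, hv, hv'⟩ := hs.same_cons hn g
  exact ⟨m, v, hv', hv⟩

theorem mem_eval_limit {d d' : D.Ob} (t : KanTerm F I d) (p : Quiver.Path d d')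
    (y : hs.limit.J d') (h : y ∈ hs.limit.eval (Quotient.mk _ t : hs.limit.J d) p) :
    y = Quotient.mk _ (t.comp p) := by
  induction p with
  | nil => exact h
  | cons p g ih =>
    obtain ⟨z, hz, e⟩ := h
    obtain rfl := ih z hz
    exact hs.edge_limit e

theorem total_limit : hs.limit.Total := by
  intro d d' g u
  obtain ⟨t, rfl⟩ := Quotient.exists_rep u
  exact ⟨_, t, rfl, rfl⟩

theorem reachable_limit : hs.limit.Reachable := by
  intro d v
  obtain ⟨⟨c, x, p⟩, rfl⟩ := Quotient.exists_rep v
  refine ⟨c, x, p, ?_⟩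
  obtain ⟨w, hw⟩ := hs.total_limit.exists_eval (hs.limit.η c x) p
  have := hs.mem_eval_limit _ _ _ hw
  rw [KanTerm.comp, Quiver.Path.nil_comp] at this
  exact this ▸ hw

/-- Two terms involve only finitely many missing values, so a single saturated stage evaluates both.
-/
theorem exists_stage {d d' : D.Ob} (t : KanTerm F I d) (t' : KanTerm F I d') :
    ∃ m, (s m).Saturated ∧ (∃ v, v ∈ (s m).value t) ∧ ∃ w, w ∈ (s m).value t' := by
  obtain ⟨n, v, hv, -⟩ := hs.same_refl t
  obtain ⟨n', v', hv', -⟩ := hs.same_refl t'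
  obtain ⟨m, hm, hsat⟩ := hs.saturated (max n n')
  obtain ⟨k⟩ := hs.hom (le_trans (le_max_left _ _) hm)
  obtain ⟨k'⟩ := hs.hom (le_trans (le_max_right _ _) hm)
  exact ⟨m, hsat, ⟨_, k.mem_value hv⟩, ⟨_, k'.mem_value hv'⟩⟩

/-- A coincidence in the limit is a statement about two terms, and it becomes an equality at one
saturated stage at which both have values. -/
theorem saturated_limit : hs.limit.Saturated := by
  rintro d v w (⟨p, q, e, u, _, _, hv, hv'⟩ | ⟨f, x, _, hv⟩ | ⟨g, u, _, _, hv, hv', -⟩)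
  · obtain ⟨t, rfl⟩ := Quotient.exists_rep u
    rw [hs.mem_eval_limit _ _ _ hv, hs.mem_eval_limit _ _ _ hv']
    refine Quotient.sound ?_
    obtain ⟨m, hsat, ⟨a, ha⟩, ⟨b, hb⟩⟩ := hs.exists_stage (t.comp p) (t.comp q)
    obtain ⟨a', ha', ha⟩ := ((s m).eval_comp _ _ _ _).1 ha
    obtain ⟨b', hb', hb⟩ := ((s m).eval_comp _ _ _ _).1 hb
    obtain rfl := hsat.eval_unique ha' hb'
    obtain rfl := hsat _ _ _ (Or.inl ⟨p, q, e, a', a, b, ha, hb⟩)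
    exact ⟨m, a, ((s m).eval_comp _ _ _ _).2 ⟨_, ha', ha⟩, ((s m).eval_comp _ _ _ _).2 ⟨_, ha', hb⟩⟩
  · have e := hs.mem_eval_limit _ _ _ hv
    rw [KanTerm.comp, Quiver.Path.nil_comp] at e
    rw [e]
    refine Quotient.sound ?_
    obtain ⟨m, hsat, ⟨a, ha⟩, -⟩ :=
      hs.exists_stage (⟨_, x, F.map f⟩ : KanTerm F I _) (⟨_, x, F.map f⟩ : KanTerm F I _)
    have := hsat _ _ _ (Or.inr (Or.inl ⟨f, x, a, ha⟩))
    exact ⟨m, a, this.symm, ha⟩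
  · obtain ⟨t, rfl⟩ := Quotient.exists_rep u
    rw [hs.edge_limit hv, hs.edge_limit hv']

/-- If the limit is finite, the saturated states of the chain are eventually total. -/
theorem eventually_total (hC : C.IsFinite) (hD : D.IsFinite) (hI : ∀ c, Finite (I.obj c))
    (hr : ∀ n, (s n).Reachable) (hfin : ∀ d, Finite (hs.limit.J d)) :
    ∃ N, ∀ m, N ≤ m → (s m).Saturated → (s m).Total := by
  have := hC.ob
  have := hD.ob
  have := hD.hom
  let rep : ∀ d, hs.limit.J d → KanTerm F I d := fun d X => Quotient.out X
  have hrep : ∀ d (t : KanTerm F I d), ∃ n, (s n).Same t (rep d (Quotient.mk _ t)) := fun d t =>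
    (hs.setoid d).symm (Quotient.mk_out t)
  choose N hN using hrep
  -- `A` bounds the stage at which a generator applied to a representative has met the
  -- representative of its class, and `B` does this for `η(x)`. Both have finite domains, so a
  -- single stage bounds all of them.
  let A : (Σ d : D.Ob, hs.limit.J d × Σ d' : D.Ob, (d ⟶ d')) → ℕ := fun a =>
    N _ ((rep a.1 a.2.1).cons a.2.2.2)
  let B : (Σ c : C.Ob, I.obj c) → ℕ := fun b => N _ ⟨b.1, b.2, .nil⟩
  obtain ⟨a, ha⟩ := (Set.finite_range A).bddAbove
  obtain ⟨b, hb⟩ := (Set.finite_range B).bddAbove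
  refine ⟨max a b, fun m hm hsat => ?_⟩
  have hA : ∀ {d d' : D.Ob} (X : hs.limit.J d) (g : d ⟶ d'), ∃ Y : hs.limit.J d',
      (s m).Same ((rep d X).cons g) (rep d' Y) := fun {d d'} X g =>
    ⟨_, hs.same_mono ((ha ⟨⟨d, X, d', g⟩, rfl⟩).trans ((le_max_left _ _).trans hm)) (hN _ _)⟩
  have hB : ∀ (c : C.Ob) (x : I.obj c), ∃ Y : hs.limit.J (F.obj c),
      (s m).Same ⟨c, x, .nil⟩ (rep _ Y) := fun c x =>
    ⟨_, hs.same_mono ((hb ⟨⟨c, x⟩, rfl⟩).trans ((le_max_right _ _).trans hm)) (hN _ _)⟩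
  -- By reachability and induction on the path, every element present at stage `m` is already the
  -- value of a representative.
  have key : ∀ (d : D.Ob) (v : (s m).J d), ∃ X, v ∈ (s m).value (rep d X) := by
    intro d v
    obtain ⟨c, x, p, hv⟩ := hr m d v
    induction p with
    | nil =>
      obtain ⟨Y, w, hw, hY⟩ := hB c x
      obtain rfl : w = v := Eq.trans hw (Eq.symm hv)
      exact ⟨Y, hY⟩
    | cons p g ih =>
      obtain ⟨v', hv', e⟩ := hv
      obtain ⟨X, hX⟩ := ih v' hv'
      obtain ⟨Y, w, hw, hY⟩ := hA X g
      obtain rfl : w = v := hsat.value_unique hw ⟨v', hX, e⟩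
      exact ⟨Y, hY⟩
  intro d d' g u
  obtain ⟨X, hX⟩ := key d u
  -- The term `g` applied to the representative of `u` has a value at this stage. Its chain ends
  -- with an edge out of the unique value of that representative, which is `u`.
  obtain ⟨Y, w, ⟨u', hu', e⟩, -⟩ := hA X g
  obtain rfl := hsat.value_unique hX hu'
  exact ⟨w, e⟩

/-- The limit is a model, so the universal property of `K` yields a map to it. Reachability of the
limit makes the map surjective, so initiality of the limit is not needed. -/
theorem finite_limit {K : D.Cat ⥤ Type u} {κ : I.functor ⟶ F.functor ⋙ K}
    (hK : K.IsLeftKanExtension κ) (hfin : ∀ d : D.Cat, Finite (K.obj d)) (d : D.Ob) :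
    Finite (hs.limit.J d) := by
  let θ := K.descOfIsLeftKanExtension κ _ (hs.limit.unit hs.total_limit hs.saturated_limit)
  have hθ : κ ≫ Functor.whiskerLeft F.functor θ = _ :=
    K.descOfIsLeftKanExtension_fac κ _ (hs.limit.unit hs.total_limit hs.saturated_limit)
  let k := KanState.homOfNatTrans hs.total_limit hs.saturated_limit θ hθ
  have := hfin (D.proj.obj d)
  exact Finite.of_surjective (α := K.obj (D.proj.obj d)) (k.toFun d)
    (k.surjective (KanState.total_ofFunctor _ _) hs.saturated_limit hs.reachable_limit d)

end IsFairChain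

/-! ### Termination -/

theorem nonempty_hom_kanStep (x : Loc × KanState F I) : Nonempty (x.2.Hom (kanStep x).2) := by
  obtain ⟨first | _ | _, s⟩ := x
  · by_cases hg : (activeTgds (cogTheory F) s.toInst).Nonempty ∨ first = true
    · rw [kanStep_outer_of_guard hg]
      exact ⟨s.toAlpha⟩
    · rw [kanStep_outer_of_not_guard hg]
      exact ⟨KanState.Hom.id s⟩
  · by_cases hg : (activeEgds (cogTheory F) s.toInst).Nonempty
    · rw [kanStep_inner_of_guard hg]
      exact ⟨s.toGamma⟩
    · rw [kanStep_inner_of_not_guard hg]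
      exact ⟨KanState.Hom.id s⟩
  · exact ⟨KanState.Hom.id s⟩

theorem nonempty_hom_iterate (x : Loc × KanState F I) (n : ℕ) :
    Nonempty (x.2.Hom (kanStep^[n] x).2) := by
  induction n with
  | zero => exact ⟨KanState.Hom.id _⟩
  | succ n ih =>
    rw [Function.iterate_succ_apply']
    obtain ⟨h⟩ := ih
    obtain ⟨k⟩ := nonempty_hom_kanStep (kanStep^[n] x)
    exact ⟨h.comp k⟩

/-- The inner loop terminates. -/
theorem exists_exit_inner (hD : D.IsFinite) (s : KanState F I) (h : Invariant (.inner, s)) :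
    ∃ k, (kanStep^[k] (.inner, s)).1 = .outer false := by
  have := hD.ob
  induction hn : Nat.card (Σ d, s.J d) using Nat.strong_induction_on generalizing s with
  | _ n ih =>
    by_cases hg : (activeEgds (cogTheory F) s.toInst).Nonempty
    · have h' := h.kanStep hD
      have e := kanStep_inner_of_guard hg
      rw [e] at h'
      have hfin : ∀ d, Finite (s.J d) := h.finite
      have hlt : Nat.card (Σ d, s.betaD.betaF.delta.gamma.J d) < n := by
        rw [← hn]
        let π : (Σ d, s.J d) → Σ d, s.betaD.betaF.delta.gamma.J d :=
          fun x => ⟨x.1, s.toGamma.toFun x.1 x.2⟩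
        have surj : Function.Surjective π := by
          rintro ⟨d, y⟩
          obtain ⟨v, rfl⟩ := Quotient.exists_rep y
          exact ⟨⟨d, v⟩, rfl⟩
        -- A surjection between finite sets that does not lower the cardinality is injective, but
        -- the quotient collapses a nontrivial coincidence.
        by_contra! hle
        have inj := (surj.bijective_of_nat_card_le hle).1
        obtain ⟨d, v, w, hvw, hne⟩ := s.activeEgds_nonempty_iff.1 hg
        have hq : s.toGamma.toFun d v = s.toGamma.toFun d w :=
          Quotient.sound ((s.delta_sim_iff (h.sim rfl) d v w).2 (.rel _ _ hvw))
        have := @inj ⟨d, v⟩ ⟨d, w⟩ (congrArg (Sigma.mk d) hq)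
        cases this
        exact hne rfl
      obtain ⟨k, hk⟩ := ih _ hlt _ h' rfl
      exact ⟨k + 1, by rw [Function.iterate_succ_apply, e]; exact hk⟩
    · exact ⟨1, by rw [Function.iterate_one, kanStep_inner_of_not_guard hg]⟩

/-- A run that does not halt passes the test of the outer loop infinitely often. -/
theorem exists_outer (hD : D.IsFinite) {x : Loc × KanState F I} (h : Invariant x)
    (hx : ∀ n, (kanStep^[n] x).1 ≠ .done) (n : ℕ) :
    ∃ m, n ≤ m ∧ (kanStep^[m] x).1 = .outer false := by
  have inner : ∀ n, (kanStep^[n] x).1 = .inner →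
      ∃ m, n ≤ m ∧ (kanStep^[m] x).1 = .outer false := by
    intro n hn
    have hinv := h.iterate hD n
    rcases hy : kanStep^[n] x with ⟨l, s⟩
    rw [hy] at hn hinv
    obtain rfl : l = .inner := hn
    obtain ⟨k, hk⟩ := exists_exit_inner hD s hinv
    exact ⟨k + n, Nat.le_add_left _ _, by rw [Function.iterate_add_apply, hy, hk]⟩
  have hn := hx n
  have hn' := hx (n + 1)
  rcases hy : kanStep^[n] x with ⟨first | _ | _, s⟩
  · have e : kanStep^[n + 1] x = kanStep (.outer first, s) := by
      rw [Function.iterate_succ_apply', hy]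
    by_cases hg : (activeTgds (cogTheory F) s.toInst).Nonempty ∨ first = true
    · rw [kanStep_outer_of_guard hg] at e
      obtain ⟨m, hm, hm'⟩ := inner (n + 1) (by rw [e])
      exact ⟨m, by omega, hm'⟩
    · rw [kanStep_outer_of_not_guard hg] at e
      exact absurd (by rw [e]) hn'
  · exact inner n (by rw [hy])
  · exact absurd (by rw [hy]) hn

/-- The outer loop is tested infinitely often and always at a saturated state. A value missing at
stage `n` is supplied, for the image of its argument, by the `α` that follows the next test. -/
theorem isFairChain_of_not_done (hD : D.IsFinite) {x : Loc × KanState F I} (h : Invariant x)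
    (hx : ∀ n, (kanStep^[n] x).1 ≠ .done) : IsFairChain fun n => (kanStep^[n] x).2 := by
  have hom : ∀ {n m : ℕ}, n ≤ m → Nonempty ((kanStep^[n] x).2.Hom (kanStep^[m] x).2) := by
    intro n m hnm
    obtain ⟨k, rfl⟩ := Nat.exists_eq_add_of_le' hnm
    rw [Function.iterate_add_apply]
    exact nonempty_hom_iterate _ k
  refine ⟨hom, fun n => ?_, fun n d d' g u => ?_⟩
  · obtain ⟨m, hm, hm'⟩ := exists_outer hD h hx n
    exact ⟨m, hm, (h.iterate hD m).saturated (Or.inl hm')⟩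
  · obtain ⟨m, hm, hm'⟩ := exists_outer hD h hx n
    obtain ⟨k⟩ := hom hm
    have hd := hx (m + 1)
    rw [Function.iterate_succ_apply'] at hd
    suffices hs : ∃ k' : (kanStep^[m] x).2.Hom (kanStep (kanStep^[m] x)).2,
        ∃ v, (kanStep (kanStep^[m] x)).2.edge g (k'.toFun d (k.toFun d u)) v by
      refine ⟨m + 1, ?_⟩
      rw [Function.iterate_succ_apply']
      obtain ⟨k', v, hv⟩ := hs
      exact ⟨k.comp k', v, hv⟩
    generalize k.toFun d u = w
    revert w
    generalize kanStep^[m] x = y at hm' hd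
    intro w
    obtain ⟨l, s⟩ := y
    obtain rfl : l = .outer false := hm'
    by_cases hg : (activeTgds (cogTheory F) s.toInst).Nonempty ∨ false = true
    · rw [kanStep_outer_of_guard hg]
      refine ⟨s.toAlpha, ?_⟩
      by_cases hv : ∃ v, s.edge g w v
      · obtain ⟨v, hv⟩ := hv
        exact ⟨_, s.toAlpha.edge g hv⟩
      · exact ⟨_, KanState.AlphaEdge.new (s := s.resetSim) g w hv⟩
    · rw [kanStep_outer_of_not_guard hg] at hd
      exact absurd rfl hd

/-- Runs halt if the left Kan extension is finite. -/
theorem exists_done (hC : C.IsFinite) (hD : D.IsFinite) (hI : ∀ c, Finite (I.obj c))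
    {x : Loc × KanState F I} (h : Invariant x) {K : D.Cat ⥤ Type u}
    {κ : I.functor ⟶ F.functor ⋙ K} (hK : K.IsLeftKanExtension κ)
    (hfin : ∀ d : D.Cat, Finite (K.obj d)) : ∃ n, (kanStep^[n] x).1 = .done := by
  by_contra! hx
  have hs := isFairChain_of_not_done hD h hx
  obtain ⟨N, hN⟩ := hs.eventually_total hC hD hI (fun n => (h.iterate hD n).reachable)
    (hs.finite_limit hK hfin)
  obtain ⟨m, hm, hm'⟩ := exists_outer hD h hx N
  -- At this test the state is saturated and hence total, so the next transition would halt.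
  have ht := hN m hm ((h.iterate hD m).saturated (Or.inl hm'))
  have hd := hx (m + 1)
  rw [Function.iterate_succ_apply'] at hd
  revert ht hd hm'
  generalize kanStep^[m] x = y
  obtain ⟨l, s⟩ := y
  intro hl ht hd
  obtain rfl : l = .outer false := hl
  have hg : ¬ ((activeTgds (cogTheory F) s.toInst).Nonempty ∨ false = true) := by
    simpa using s.total_iff.1 ht
  rw [kanStep_outer_of_not_guard hg] at hd
  exact hd rfl

/-- The result of a run is a finite left Kan extension. -/
theorem Invariant.exists_isLeftKanExtension {x : Loc × KanState F I} (h : Invariant x)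
    (hx : x.1 = .done) :
    ∃ (K : D.Cat ⥤ Type u) (κ : I.functor ⟶ F.functor ⋙ K),
      K.IsLeftKanExtension κ ∧ (∀ d : D.Cat, Finite (K.obj d)) ∧ x.2.Represents K κ :=
  have ht := h.total hx
  have hs := h.saturated (Or.inr hx)
  ⟨_, _, x.2.isLeftKanExtension ht hs h.reachable h.weaklyInitial, fun d => h.finite d.as,
    x.2.represents_toFunctor ht hs⟩

end Limit

/-! ### Comparison of the runs -/

section Comparison

variable {C D : CatPres.{u}} {F : PresMor C D} {I : Algebra C}

theorem chaseStep_initial (F : PresMor C D) (I : Algebra C) :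
    ChaseStep (cogTheory F) (ChaseConfig.start (inputInst F I))
      ⟨.inner, (KanState.initial F I).toInst, (KanState.initial F I).fromInput⟩ := by
  have := ChaseStep.tgds true (𝟙 (inputInst F I)) _ (Or.inr rfl)
    (KanState.isParallelStep_initial F I)
  rw [Category.id_comp] at this
  exact this

theorem reflTransGen_chaseStep (hD : D.IsFinite) {x : Loc × KanState F I} (hx : Invariant x)
    (n : ℕ) : Relation.ReflTransGen (ChaseStep (cogTheory F)) (toChase x)
      (toChase (kanStep^[n] x)) := by
  induction n with
  | zero => exact .refl
  | succ n ih =>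
    rw [Function.iterate_succ_apply']
    have h := hx.iterate hD n
    generalize kanStep^[n] x = y at ih h
    by_cases hd : y.1 = .done
    · obtain ⟨l, s⟩ := y
      obtain rfl : l = .done := hd
      exact ih
    · exact ih.tail (chaseStep_kanStep y h.sim hd)

/-- The chase is free to choose any pushout at each step. Determinism up to isomorphism lets the
concrete run shadow it transition by transition. -/
theorem exists_equivalent_of_reflTransGen (hD : D.IsFinite)
    {x y : ChaseConfig (inputInst F I)} (hxy : Relation.ReflTransGen (ChaseStep (cogTheory F)) x y)
    {k : Loc × KanState F I} (hk : Invariant k)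
    (hkx : (toChase k).Equivalent x) : ∃ n, (toChase (kanStep^[n] k)).Equivalent y := by
  induction hxy using Relation.ReflTransGen.head_induction_on generalizing k with
  | refl => exact ⟨0, hkx⟩
  | head hstep _ ih =>
    have hd : k.1 ≠ .done := fun e => hstep.loc_ne_done (hkx.1.symm.trans e)
    obtain ⟨n, hn⟩ := ih (hk.kanStep hD)
      (ChaseStep.equivalent hkx (chaseStep_kanStep k hk.sim hd) hstep)
    exact ⟨n + 1, hn⟩

/-- The run that starts at the test of the inner loop follows the chase on the input. -/
theorem exists_equivalent_of_chaseComputes (hD : D.IsFinite)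
    (hB : Invariant (Loc.inner, KanState.initial F I)) {X : Inst (cograph F).signature}
    {i : inputInst F I ⟶ X} (h : ChaseComputes (cogTheory F) (inputInst F I) i) :
    ∃ n, (toChase (kanStep^[n] (Loc.inner, KanState.initial F I))).Equivalent ⟨.done, X, i⟩ := by
  obtain e | ⟨y, hy, hy'⟩ := h.cases_head
  · exact absurd (congrArg ChaseConfig.loc e) (by simp [ChaseConfig.start])
  · exact exists_equivalent_of_reflTransGen hD hy' hB
      (ChaseStep.equivalent (.refl _) (chaseStep_initial F I) hy)

theorem KanState.length_eq_zero_of_mem_eval_initial {d d' : D.Ob}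
    {u : (KanState.initial F I).J d} {p : Quiver.Path d d'} {v : (KanState.initial F I).J d'}
    (h : v ∈ (KanState.initial F I).eval u p) : p.length = 0 := by
  cases p with
  | nil => rfl
  | cons p g => exact h.elim fun _ h => h.2.elim

/-- S₀ has no edges, so only paths of length zero have values. Equations between such paths are
trivial, and `β_F` would require some `F(f)` of length zero. -/
theorem KanState.saturated_initial
    (hF : ∀ (c c' : C.Ob) (f : c ⟶ c'), (F.map f).length ≠ 0) :
    (KanState.initial F I).Saturated := by
  rintro d v w (⟨p, q, e, u, _, _, hv, hv'⟩ | ⟨f, x, _, hv⟩ | ⟨g, u, _, _, hv, hv', -⟩)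
  · cases p with
    | nil =>
      cases q with
      | nil => exact Eq.trans hv (Eq.symm hv')
      | cons q g => exact hv'.elim fun _ h => h.2.elim
    | cons p g => exact hv.elim fun _ h => h.2.elim
  · exact absurd (KanState.length_eq_zero_of_mem_eval_initial hv) (hF _ _ f)
  · exact hv.elim

/-- If nothing is missing, `α` changes nothing. -/
theorem KanState.Total.exists_iso_alpha {s : KanState F I} (h : s.Total) :
    ∃ e : s.toInst ≅ s.resetSim.alpha.toInst, s.fromInput ≫ e.hom = s.resetSim.alpha.fromInput := by
  let k : s.resetSim.alpha.Hom s :=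
    { toFun := fun d => Sum.elim (fun v => v) fun m => absurd (h m.g m.u) m.missing
      edge := by
        intro d d' g u v e
        cases e with
        | old u v e => exact e
        | new u e => exact absurd (h g u) e
      η := fun _ _ => rfl }
  refine ⟨⟨s.toAlpha.toInst, k.toInst, ?_, ?_⟩, KanState.fromInput_comp _⟩
  · exact Inst.hom_ext fun a x => by rcases a with c | d <;> rfl
  · refine Inst.hom_ext fun a x => ?_
    rcases a with c | d
    · rfl
    · rcases x with x | m
      · rfl
      · exact absurd (h m.g m.u) m.missing

end Comparison
end FastKan

/-! ### The proposition: comparison of the two starting points -/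

open CategoryTheory FastKan in
theorem mainTheorem11 {C D : CatPres.{u}} (hC : C.IsFinite) (hD : D.IsFinite)
    (F : PresMor C D) (I : Algebra C) (hI : ∀ c : C.Ob, Finite (I.obj c)) :
    -- the first loop is the first tgd step of the fast parallel chase for `cog(F)` on the input
    ChaseStep (cogTheory F) (ChaseConfig.start (inputInst F I))
        ⟨.inner, (KanState.initial F I).toInst, (KanState.initial F I).fromInput⟩ ∧
    -- each transition of the remaining algorithm is the transition of the fast parallel chase
    (∀ n : ℕ, (kanRun F I n).1 ≠ .done →
      ChaseStep (cogTheory F) (toChase (kanRun F I n)) (toChase (kanRun F I (n + 1)))) ∧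
    -- if no generating morphism is sent to a trivial path, the initial state satisfies all egds
    ((∀ (c c' : C.Ob) (f : c ⟶ c'), (F.map f).length ≠ 0) →
      ¬ (activeEgds (cogTheory F) (KanState.initial F I).toInst).Nonempty) ∧
    -- if the initial state satisfies all egds, the two runs agree
    (¬ (activeEgds (cogTheory F) (KanState.initial F I).toInst).Nonempty →
      ChaseStep (cogTheory F)
        ⟨.inner, (KanState.initial F I).toInst, (KanState.initial F I).fromInput⟩
        ⟨.outer false, (KanState.initial F I).toInst, (KanState.initial F I).fromInput⟩ ∧
      ((activeTgds (cogTheory F) (KanState.initial F I).toInst).Nonempty →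
        ChaseStep (cogTheory F)
          ⟨.outer false, (KanState.initial F I).toInst, (KanState.initial F I).fromInput⟩
          (toChase (kanRun F I 1))) ∧
      (¬ (activeTgds (cogTheory F) (KanState.initial F I).toInst).Nonempty →
        ChaseStep (cogTheory F)
          ⟨.outer false, (KanState.initial F I).toInst, (KanState.initial F I).fromInput⟩
          ⟨.done, (KanState.initial F I).toInst, (KanState.initial F I).fromInput⟩ ∧
        (kanRun F I 3).1 = .done ∧
        ∃ e : (KanState.initial F I).toInst ≅ (kanRun F I 3).2.toInst,
          (KanState.initial F I).fromInput ≫ e.hom = (kanRun F I 3).2.fromInput)) ∧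
    -- the two algorithms halt on the same inputs, with isomorphic results
    ((∃ n : ℕ, (kanRun F I n).1 = .done) ↔
      ∃ (X : Inst (cograph F).signature) (i : inputInst F I ⟶ X),
        ChaseComputes (cogTheory F) (inputInst F I) i) ∧
    (∀ (n : ℕ) (X : Inst (cograph F).signature) (i : inputInst F I ⟶ X),
      (kanRun F I n).1 = .done → ChaseComputes (cogTheory F) (inputInst F I) i →
      ∃ e : (kanRun F I n).2.toInst ≅ X, (kanRun F I n).2.fromInput ≫ e.hom = i) ∧
    -- when the algorithm halts, its result is a left Kan extension, and it is finite
    (∀ n : ℕ, (kanRun F I n).1 = .done →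
      ∃ (K : D.Cat ⥤ Type u) (κ : I.functor ⟶ F.functor ⋙ K),
        K.IsLeftKanExtension κ ∧ (∀ d : D.Cat, Finite (K.obj d)) ∧
        (kanRun F I n).2.Represents K κ) ∧
    -- the algorithm halts whenever the left Kan extension is finite
    (∀ (K : D.Cat ⥤ Type u) (κ : I.functor ⟶ F.functor ⋙ K), K.IsLeftKanExtension κ →
      (∀ d : D.Cat, Finite (K.obj d)) → ∃ n : ℕ, (kanRun F I n).1 = .done) := by
  -- `hA` concerns the run of the algorithm and `hB` the run that follows the chase.
  have hA : Invariant (Loc.outer true, KanState.initial F I) :=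
    invariant_initial hC hI (Or.inl rfl)
  have hB : Invariant (Loc.inner, KanState.initial F I) := invariant_initial hC hI (Or.inr rfl)
  have hrun : ∀ n, Invariant (kanRun F I n) := fun n => hA.iterate hD n
  have hsucc : ∀ n, kanRun F I (n + 1) = kanStep (kanRun F I n) := fun n =>
    Function.iterate_succ_apply' _ _ _
  have h₁ : kanRun F I 1 = (.inner, (KanState.initial F I).resetSim.alpha) :=
    kanStep_outer_of_guard (Or.inr rfl)
  refine ⟨chaseStep_initial F I, fun n hn => ?_, fun hF => ?_, fun hE => ⟨?_, fun hT => ?_,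
    fun hT => ?_⟩, ⟨?_, ?_⟩, fun n X i hn hX => ?_, fun n hn => ?_, fun K κ hK hfin => ?_⟩
  · rw [hsucc]
    exact chaseStep_kanStep _ (hrun n).sim hn
  · exact (KanState.saturated_iff _).1 (KanState.saturated_initial hF)
  · exact .exitInner _ hE
  · have := chaseStep_kanStep (Loc.outer false, KanState.initial F I) (fun h => nomatch h) (by simp)
    rw [kanStep_outer_of_guard (Or.inl hT)] at this
    rw [h₁]
    exact this
  -- Here `α` adds nothing up to `e`, so active triggers would transport back to S₀. Both loop tests
  -- fail, and the run takes three transitions: `α` and the two exits.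
  · obtain ⟨e, he⟩ := ((KanState.total_iff _).2 hT).exists_iso_alpha
    have h₂ : kanRun F I 2 = (.outer false, (KanState.initial F I).resetSim.alpha) := by
      rw [hsucc, h₁]
      exact kanStep_inner_of_not_guard fun h => hE (activeEgds_nonempty_of_iso e.symm h)
    have h₃ : kanRun F I 3 = (.done, (KanState.initial F I).resetSim.alpha) := by
      rw [hsucc, h₂]
      refine kanStep_outer_of_not_guard ?_
      rintro (h | h)
      · exact hT (activeTgds_nonempty_of_iso e.symm h)
      · cases h
    rw [h₃]
    exact ⟨.exitOuter _ hT, rfl, e, he⟩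
  · rintro ⟨n, hn⟩
    -- Halting passes from one run to the other through finiteness of the left Kan extension, since
    -- the intermediate states are not comparable directly.
    obtain ⟨K, κ, hK, hfin, -⟩ := (hrun n).exists_isLeftKanExtension hn
    obtain ⟨m, hm⟩ := exists_done hC hD hI hB hK hfin
    have := reflTransGen_chaseStep hD hB m
    rcases hy : kanStep^[m] (Loc.inner, KanState.initial F I) with ⟨l, s⟩
    rw [hy] at this hm
    obtain rfl : l = .done := hm
    exact ⟨s.toInst, s.fromInput, this.head (chaseStep_initial F I)⟩
  · rintro ⟨X, i, hX⟩
    obtain ⟨m, hm, -⟩ := exists_equivalent_of_chaseComputes hD hB hX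
    obtain ⟨K, κ, hK, hfin, -⟩ := (hB.iterate hD m).exists_isLeftKanExtension hm
    exact exists_done hC hD hI hA hK hfin
  · obtain ⟨m, hm, e, he⟩ := exists_equivalent_of_chaseComputes hD hB hX
    change (kanStep^[m] (Loc.inner, KanState.initial F I)).2.toInst ≅ X at e
    change (kanStep^[m] (Loc.inner, KanState.initial F I)).2.fromInput ≫ e.hom = i at he
    have hm' := hB.iterate hD m
    -- Both final states are reachable and weakly initial models, hence isomorphic under the input.
    obtain ⟨e', he'⟩ := KanState.exists_iso ((hrun n).total hn) ((hrun n).saturated (Or.inr hn))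
      (hrun n).reachable (hrun n).weaklyInitial (hm'.total hm) (hm'.saturated (Or.inr hm))
      hm'.reachable hm'.weaklyInitial
    refine ⟨e' ≪≫ e, ?_⟩
    rw [Iso.trans_hom, ← Category.assoc, he']
    exact he
  · exact (hrun n).exists_isLeftKanExtension hn
  · exact exists_done hC hD hI hA hK hfin
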